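/- Let $(M,g)$ be a smooth ($C^\infty$) Riemannian surface, let $y\in M$, and let $G$ be a Green's function of $(M,g)$ with pole $y$, that is, a locally integrable function on $M$, smooth on $M\setminus\{y\}$, with $\Delta_g G=-\delta_y$ in the sense of distributions. Let $(\mathcal M,g_0)$ be a smooth Riemannian surface of constant Gaussian curvature, and let $\Phi:\mathcal M\to M$ be a conformal isometry, that is, a $C^\infty$ diffeomorphism such that $\Phi^*g=f\,g_0$ for some smooth positive function $f$ on $\mathcal M$. Set $\widehat G:=G\circ\Phi$ and $\widehat y:=\Phi^{-1}(y)$. Then there are $C^\infty$ coordinates $(x_1,x_2)$, defined in an open neighborhood $U$ of $\widehat y$ in $\mathcal M$ and centered at $\widehat y$, and a smooth nonnegative function $\rho:U\to\mathbb R$ that vanishes only at $\widehat y$, such that $$\rho\,\nabla_{g_0}\widehat G=-x_1\,\frac{\partial}{\partial x_1}-x_2\,\frac{\partial}{\partial x_2}\qquad\text{in } U\setminus\{\widehat y\}.$$ In particular, for the field $\rho\,\nabla_{g_0}\widehat G$, extended by $0$ to $\widehat y$, the point $\widehat y$ is a linearizable stable node: in suitable smooth coordinates centered at $\widehat y$ the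 field is linear, $\dot x=Ax$, where both eigenvalues of the matrix $A$ are real and negative. -/

import Mathlib

open Set MeasureTheory Bundle
open scoped Manifold ContDiff Topology

/-- The coordinate plane `ℝ²`, with its Euclidean structure. -/
abbrev Plane : Type := EuclideanSpace ℝ (Fin 2)

/-- Smooth Riemannian metrics on a smooth surface `M`. -/
abbrev SurfaceMetric (M : Type*) [TopologicalSpace M] [ChartedSpace Plane M]
    [IsManifold (𝓡 2) ∞ M] : Type _ :=
  ContMDiffRiemannianMetric (𝓡 2) ∞ Plane (fun p : M => TangentSpace (𝓡 2) p)

/-- The partial derivative `∂F/∂uᵢ` of a function on the coordinate plane. -/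
noncomputable def partialDeriv (i : Fin 2) (F : Plane → ℝ) (u : Plane) : ℝ :=
  fderiv ℝ F u (EuclideanSpace.single i 1)

namespace Surface

section Charts

variable {M : Type*} [TopologicalSpace M] [ChartedSpace Plane M]

/-- The coordinate vector `∂/∂xᵢ` of the chart `e`, at the point `e.symm u`
(meaningful for `u ∈ e.target`). -/
noncomputable def coordVector (e : OpenPartialHomeomorph M Plane) (i : Fin 2) (u : Plane) :
    TangentSpace (𝓡 2) (e.symm u) :=
  mfderiv (𝓡 2) (𝓡 2) e.symm u (EuclideanSpace.single i (1 : ℝ) : Plane)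

variable [IsManifold (𝓡 2) ∞ M]

/-- The matrix `(gᵢⱼ)` of the metric `g` in the chart `e`, as a function of the coordinates. -/
noncomputable def metricMatrix (g : SurfaceMetric M) (e : OpenPartialHomeomorph M Plane)
    (u : Plane) : Matrix (Fin 2) (Fin 2) ℝ :=
  Matrix.of fun i j => g.inner (e.symm u) (coordVector e i u) (coordVector e j u)

/-- The density `√(det gᵢⱼ)` of the Riemannian area in the chart `e`. -/
noncomputable def areaDensity (g : SurfaceMetric M) (e : OpenPartialHomeomorph M Plane)
    (u : Plane) : ℝ :=
  Real.sqrt (metricMatrix g e u).det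

/-- The Laplace–Beltrami operator of `g` in the chart `e`,
`Δφ = (1/√g) ∑ᵢ ∂ᵢ (∑ⱼ √g gⁱʲ ∂ⱼφ)`. -/
noncomputable def coordLaplacian (g : SurfaceMetric M) (e : OpenPartialHomeomorph M Plane)
    (φ : Plane → ℝ) (u : Plane) : ℝ :=
  (areaDensity g e u)⁻¹ * ∑ i, partialDeriv i
    (fun v => ∑ j, areaDensity g e v * (metricMatrix g e v)⁻¹ i j * partialDeriv j φ v) u

/-- The Christoffel symbol `Γᵏᵢⱼ` of `g` in the chart `e`. -/
noncomputable def christoffel (g : SurfaceMetric M) (e : OpenPartialHomeomorph M Plane)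
    (k i j : Fin 2) (u : Plane) : ℝ :=
  (1 / 2) * ∑ l, (metricMatrix g e u)⁻¹ k l *
    (partialDeriv i (fun v => metricMatrix g e v j l) u
      + partialDeriv j (fun v => metricMatrix g e v i l) u
      - partialDeriv l (fun v => metricMatrix g e v i j) u)

/-- The component `Rˡₖᵢⱼ` of the curvature tensor, `R(∂ᵢ, ∂ⱼ) ∂ₖ = ∑ₗ Rˡₖᵢⱼ ∂ₗ`. -/
noncomputable def riemannTensor (g : SurfaceMetric M) (e : OpenPartialHomeomorph M Plane)
    (l k i j : Fin 2) (u : Plane) : ℝ :=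
  partialDeriv i (christoffel g e l j k) u - partialDeriv j (christoffel g e l i k) u
    + ∑ m, (christoffel g e l i m u * christoffel g e m j k u
      - christoffel g e l j m u * christoffel g e m i k u)

/-- The Gaussian curvature `g(R(∂₁, ∂₂) ∂₂, ∂₁) / det g` in the chart `e`. -/
noncomputable def gaussCurvature (g : SurfaceMetric M) (e : OpenPartialHomeomorph M Plane)
    (u : Plane) : ℝ :=
  (∑ l, metricMatrix g e u 0 l * riemannTensor g e l 1 0 1 u) / (metricMatrix g e u).det

/-- The metric `g` has constant Gaussian curvature. -/
def HasConstantCurvature (g : SurfaceMetric M) : Prop :=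
  ∃ K : ℝ, ∀ e ∈ IsManifold.maximalAtlas (𝓡 2) ∞ M, ∀ u ∈ e.target, gaussCurvature g e u = K

open Classical in
/-- `G` is a Green's function of `(M, g)` with pole `y`: a function that is smooth off `y`, locally
integrable, and satisfies `Δ_g G = -δ_y` in the sense of distributions. An identity between
distributions is local, so it is tested, in every smooth chart `e`, on the smooth functions `φ`
with compact support in the image of the chart (here `√g du` is the Riemannian area).
The value that the total function `G` takes at `y` plays no role. -/
structure IsGreenFunction (g : SurfaceMetric M) (y : M) (G : M → ℝ) : Prop where
  smooth : ContMDiffOn (𝓡 2) 𝓘(ℝ, ℝ) ∞ G {y}ᶜ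
  locallyIntegrable : ∀ e ∈ IsManifold.maximalAtlas (𝓡 2) ∞ M,
    LocallyIntegrableOn (fun u => G (e.symm u)) e.target
  laplacian_eq : ∀ e ∈ IsManifold.maximalAtlas (𝓡 2) ∞ M, ∀ φ : Plane → ℝ,
    ContDiff ℝ ∞ φ → HasCompactSupport φ → tsupport φ ⊆ e.target →
      ∫ u in e.target, G (e.symm u) * coordLaplacian g e φ u * areaDensity g e u
        = -(if y ∈ e.source then φ (e y) else 0)

/-- The metric at a point, as a linear map from tangent vectors to covectors. -/
noncomputable def flat (g : SurfaceMetric M) (p : M) :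
    TangentSpace (𝓡 2) p →ₗ[ℝ] (TangentSpace (𝓡 2) p →L[ℝ] ℝ) :=
  (g.inner p).toLinearMap

theorem flat_bijective (g : SurfaceMetric M) (p : M) : Function.Bijective (flat g p) := by
  have hinj : Function.Injective (flat g p) := by
    rw [injective_iff_map_eq_zero]
    intro v hv
    by_contra hne
    have h := g.pos p v hne
    have h0 : g.inner p v = 0 := hv
    rw [h0] at h
    simp at h
  have hfin : Module.finrank ℝ Plane = Module.finrank ℝ (Plane →L[ℝ] ℝ) := by
    rw [← LinearEquiv.finrank_eq (LinearMap.toContinuousLinearMap (𝕜 := ℝ) (E := Plane) (F' := ℝ))]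
    exact (Subspace.dual_finrank_eq (K := ℝ) (V := Plane)).symm
  exact ⟨hinj, (LinearMap.injective_iff_surjective_of_finrank_eq_finrank
    (V := Plane) (V₂ := Plane →L[ℝ] ℝ) hfin (f := flat g p)).1 hinj⟩

/-- The Riemannian gradient: the vector `∇_g G (p)` with `g(∇_g G (p), w) = dG(p) w` for all `w`. -/
noncomputable def gradient (g : SurfaceMetric M) (G : M → ℝ) (p : M) : TangentSpace (𝓡 2) p :=
  (LinearEquiv.ofBijective (flat g p) (flat_bijective g p)).symm
    (mfderiv (𝓡 2) 𝓘(ℝ, ℝ) G p)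

theorem inner_gradient (g : SurfaceMetric M) (G : M → ℝ) (p : M) (w : TangentSpace (𝓡 2) p) :
    g.inner p (gradient g G p) w = mfderiv (𝓡 2) 𝓘(ℝ, ℝ) G p w := by
  have h := LinearEquiv.apply_symm_apply
    (LinearEquiv.ofBijective (flat g p) (flat_bijective g p)) (mfderiv (𝓡 2) 𝓘(ℝ, ℝ) G p)
  exact congrArg (fun L : TangentSpace (𝓡 2) p →L[ℝ] ℝ => L w) h

/-- The point `p` is a linearizable stable node of the vector field `X`: in suitable smooth
coordinates centred at `p`, the field is linear, `ẋ = A x`, and both eigenvalues of `A` are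
real and negative. -/
def IsLinearizableStableNode (X : (q : M) → TangentSpace (𝓡 2) q) (p : M) : Prop :=
  ∃ e ∈ IsManifold.maximalAtlas (𝓡 2) ∞ M, p ∈ e.source ∧ e p = 0 ∧
    ∃ A : Matrix (Fin 2) (Fin 2) ℝ,
      (∃ a b : ℝ, a < 0 ∧ b < 0 ∧
        A.charpoly = (Polynomial.X - Polynomial.C a) * (Polynomial.X - Polynomial.C b)) ∧
      ∀ q ∈ e.source,
        (mfderiv (𝓡 2) (𝓡 2) e q (X q) : Plane) = Matrix.toEuclideanLin A (e q)

end Charts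

/-- The diffeomorphism `Φ : (M₀, g₀) → (M, g)` is a conformal isometry, `Φ^* g = f g₀` with a
smooth positive function `f`. -/
def IsConformalIsometry {M₀ M : Type*}
    [TopologicalSpace M₀] [ChartedSpace Plane M₀] [IsManifold (𝓡 2) ∞ M₀]
    [TopologicalSpace M] [ChartedSpace Plane M] [IsManifold (𝓡 2) ∞ M]
    (g₀ : SurfaceMetric M₀) (g : SurfaceMetric M) (Φ : M₀ ≃ₘ^∞⟮𝓡 2, 𝓡 2⟯ M) : Prop :=
  ∃ f : M₀ → ℝ, ContMDiff (𝓡 2) 𝓘(ℝ, ℝ) ∞ f ∧ (∀ p, 0 < f p) ∧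
    ∀ (p : M₀) (v w : TangentSpace (𝓡 2) p),
      g.inner (Φ p) (mfderiv (𝓡 2) (𝓡 2) Φ p v) (mfderiv (𝓡 2) (𝓡 2) Φ p w)
        = f p * g₀.inner p v w

end Surface

/-! Write Ĝ for G ∘ Φ. In dimension two, √g·Δ_g is the flat Laplacian in every isothermal coordinate
z. A chart isothermal for g₀ is carried by Φ to one isothermal for g, so Ĝ, read in such a chart
centred at the pole, is a Green's function of the flat Laplacian on a disc
(`Surface.IsGreenFunction.isDiscGreen`).

There p = ∂Ĝ/∂x - i ∂Ĝ/∂y is holomorphic off 0. Testing the equation on a radial cutoff of a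
holomorphic ψ gives ∮ pψ dz = -iψ(0) (`IsDiscGreen.circleIntegral_complexGradient_mul`), so that p =
P - 1/(2πz) with P holomorphic. If Q' = P, then w = z·exp(-2πQ) is a holomorphic coordinate with
w'/w = -2πp (`IsDiscGreen.exists_coordinate`); informally, Ĝ = -log|w|/2π + const. If λ is the
conformal factor of g₀, the gradient is conj(p)/λ in the coordinate z. Multiplied by w' it becomes
-|w'|²/(2πλ|w|²)·w, so ρ = 2πλ|w|²/|w'|² turns it into exactly -w (`Surface.coords_smul_gradient`).

Isothermal coordinates come from constant curvature K. The overdetermined system Hess f = -K f g₀ is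
then integrable, and g₀⁻¹(df, dh) + K f h is constant for any two solutions. Take s, t vanishing at
the centre with orthonormal differentials there, and w equal to 1 with zero differential (this w is
unrelated to the coordinate above). The stereographic quotients s/(1+w), t/(1+w) have orthogonal
differentials of equal length (`IsLocalConnection.exists_isothermal`).

Integrability is turned into solutions by a Frobenius theorem for flat linear connections
(`exists_parallel_section`): transport along rays is a fixed point problem in C([0,1], E), solved by
inverting 1 - T near 1, and flatness identifies the derivative of the solution in the base point. -/

set_option maxSynthPendingDepth 3

/-! ### Differential calculus in spaces of continuous functions -/

section ContinuousMapCalculus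

variable {X V Y : Type*} [TopologicalSpace X] [CompactSpace X]
  [NormedAddCommGroup V] [NormedSpace ℝ V] [NormedAddCommGroup Y] [NormedSpace ℝ Y]

/-- A curve of functions that is differentiable pointwise, with a derivative that is continuous
for the uniform norm, is differentiable for the uniform norm. -/
theorem ContinuousMap.hasFDerivAt_of_forall_eval {F : V → C(X, Y)} {F' : V → V →L[ℝ] C(X, Y)}
    (hF' : Continuous F')
    (h : ∀ x t, HasFDerivAt (fun y => F y t) ((ContinuousMap.evalCLM ℝ t).comp (F' x)) x) (x : V) :
    HasFDerivAt F (F' x) x := by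
  rw [hasFDerivAt_iff_isLittleO_nhds_zero, Asymptotics.isLittleO_iff]
  intro c hc
  have h1 : ∀ᶠ y in 𝓝 x, ‖F' y - F' x‖ ≤ c := by
    have := (hF'.sub continuous_const).norm.tendsto' x 0 (by simp) (f := fun y => ‖F' y - F' x‖)
    exact this.eventually_le_const hc
  obtain ⟨δ, hδ, hball⟩ := Metric.eventually_nhds_iff_ball.1 h1
  filter_upwards [Metric.ball_mem_nhds (0 : V) hδ] with v hv
  rw [ContinuousMap.norm_le _ (by positivity)]
  intro t
  have hmem : x + v ∈ Metric.ball x δ := by simpa using hv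
  -- The mean value inequality is applied for each t separately, but its constant c and the ball do
  -- not depend on t, which makes the estimate uniform.
  have := (convex_ball x δ).norm_image_sub_le_of_norm_hasFDerivWithin_le'
    (f := fun y => F y t) (f' := fun y => (ContinuousMap.evalCLM ℝ t).comp (F' y))
    (φ := (ContinuousMap.evalCLM ℝ t).comp (F' x)) (C := c)
    (fun y _ => (h y t).hasFDerivWithinAt) (fun y hy => ?_) (Metric.mem_ball_self hδ) hmem
  · simpa using this
  · rw [← ContinuousLinearMap.comp_sub]
    refine ContinuousLinearMap.opNorm_le_bound _ hc.le fun w => ?_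
    calc ‖((F' y - F' x) w) t‖ ≤ ‖(F' y - F' x) w‖ := ContinuousMap.norm_coe_le_norm _ t
      _ ≤ c * ‖w‖ := (ContinuousLinearMap.le_opNorm _ _).trans (by gcongr; exact hball y hy)

/-- The pointwise application of a continuous bilinear map to two continuous functions. -/
noncomputable def ContinuousMap.bilinearL (X : Type*) [TopologicalSpace X] [CompactSpace X]
    {Z : Type*} [NormedAddCommGroup Z] [NormedSpace ℝ Z] (B : Z →L[ℝ] V →L[ℝ] Y) :
    C(X, Z) →L[ℝ] C(X, V) →L[ℝ] C(X, Y) :=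
  LinearMap.mkContinuous₂
    (LinearMap.mk₂ ℝ (fun (f : C(X, Z)) (g : C(X, V)) =>
        (⟨fun t => B (f t) (g t), (B.continuous.comp f.continuous).clm_apply g.continuous⟩ :
          C(X, Y)))
      (fun _ _ _ => by ext; simp) (fun _ _ _ => by ext; simp)
      (fun _ _ _ => by ext; simp) (fun _ _ _ => by ext; simp)) ‖B‖ (by
    intro f g
    rw [ContinuousMap.norm_le _ (by positivity)]
    intro t
    refine (B.le_opNorm₂ _ _).trans ?_
    gcongr
    · exact f.norm_coe_le_norm t
    · exact g.norm_coe_le_norm t)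

@[simp]
theorem ContinuousMap.bilinearL_apply {Z : Type*} [NormedAddCommGroup Z] [NormedSpace ℝ Z]
    (B : Z →L[ℝ] V →L[ℝ] Y) (f : C(X, Z)) (g : C(X, V)) (t : X) :
    ContinuousMap.bilinearL X B f g t = B (f t) (g t) := rfl

/-- The constant functions, as a continuous linear map. -/
noncomputable def ContinuousMap.constCLM (X V : Type*) [TopologicalSpace X] [CompactSpace X]
    [NormedAddCommGroup V] [NormedSpace ℝ V] : V →L[ℝ] C(X, V) :=
  LinearMap.mkContinuous
    { toFun := fun v => ContinuousMap.const X v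
      map_add' := fun _ _ => rfl
      map_smul' := fun _ _ => rfl } 1 (by
    intro v
    rw [ContinuousMap.norm_le _ (by positivity), one_mul]
    exact fun t => le_rfl)

@[simp]
theorem ContinuousMap.constCLM_apply (v : V) (t : X) :
    ContinuousMap.constCLM X V v t = v := rfl

end ContinuousMapCalculus

/-! ### The primitive as an operator on C([0,1], E) -/

section Volterra

open unitInterval

variable {E : Type*} [NormedAddCommGroup E] [NormedSpace ℝ E]

theorem continuous_comp_projIcc {E : Type*} [TopologicalSpace E] (f : C(I, E)) :
    Continuous fun τ : ℝ => f (projIcc 0 1 zero_le_one τ) :=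
  f.continuous.comp continuous_projIcc

/-- The primitive vanishing at `0` of a continuous function on the unit interval. -/
noncomputable def primitiveL (E : Type*) [NormedAddCommGroup E] [NormedSpace ℝ E] :
    C(I, E) →L[ℝ] C(I, E) :=
  LinearMap.mkContinuous
    { toFun := fun f => ⟨fun t => ∫ τ in (0 : ℝ)..t, f (projIcc 0 1 zero_le_one τ),
        (intervalIntegral.continuous_primitive
          (fun a b => (continuous_comp_projIcc f).intervalIntegrable a b) 0).comp
          continuous_subtype_val⟩
      map_add' := fun f g => by
        ext t
        exact intervalIntegral.integral_add ((continuous_comp_projIcc f).intervalIntegrable _ _)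
          ((continuous_comp_projIcc g).intervalIntegrable _ _)
      map_smul' := fun c f => by
        ext t
        exact intervalIntegral.integral_smul c fun τ => f (projIcc 0 1 zero_le_one τ) } 1 (by
    intro f
    rw [ContinuousMap.norm_le _ (by positivity), one_mul]
    intro t
    have := intervalIntegral.norm_integral_le_of_norm_le_const (a := 0) (b := (t : ℝ))
      (f := fun τ => f (projIcc 0 1 zero_le_one τ)) (C := ‖f‖)
      (fun τ _ => f.norm_coe_le_norm _)
    refine this.trans ?_
    rw [sub_zero, abs_of_nonneg t.2.1]
    exact mul_le_of_le_one_right (norm_nonneg _) t.2.2)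

theorem primitiveL_apply (f : C(I, E)) (t : I) :
    primitiveL E f t = ∫ τ in (0 : ℝ)..t, f (projIcc 0 1 zero_le_one τ) := rfl

/-- The derivative is asked only inside the interval: curves extended by `projIcc` are constant
beyond the endpoints and need not be differentiable there. -/
theorem primitiveL_eq_of_hasDerivAt [CompleteSpace E] {f : C(I, E)} {q : ℝ → E}
    (hq : ContinuousOn q (Icc 0 1)) (h0 : q 0 = 0)
    (h : ∀ (τ : ℝ) (hτ : τ ∈ Ioo (0 : ℝ) 1), HasDerivAt q (f ⟨τ, Ioo_subset_Icc_self hτ⟩) τ)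
    (t : I) : primitiveL E f t = q t := by
  rw [primitiveL_apply, intervalIntegral.integral_eq_sub_of_hasDerivAt_of_le t.2.1
    (hq.mono (Icc_subset_Icc le_rfl t.2.2)) (fun τ hτ => ?_)
    ((continuous_comp_projIcc f).intervalIntegrable _ _), h0, sub_zero]
  have hτ' : τ ∈ Ioo (0 : ℝ) 1 := ⟨hτ.1, hτ.2.trans_le t.2.2⟩
  convert h τ hτ' using 2
  exact projIcc_of_mem _ (Ioo_subset_Icc_self hτ')

theorem hasDerivAt_primitiveL [CompleteSpace E] (f : C(I, E)) {τ : ℝ} (hτ : τ ∈ Ioo (0 : ℝ) 1) :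
    HasDerivAt (fun t => primitiveL E f (projIcc 0 1 zero_le_one t))
      (f ⟨τ, Ioo_subset_Icc_self hτ⟩) τ := by
  have h := intervalIntegral.integral_hasDerivAt_right
    ((continuous_comp_projIcc f).intervalIntegrable 0 τ)
    (continuous_comp_projIcc f).aestronglyMeasurable.stronglyMeasurableAtFilter
    (continuous_comp_projIcc f).continuousAt
  rw [projIcc_of_mem _ (Ioo_subset_Icc_self hτ)] at h
  refine h.congr_of_eventuallyEq ?_
  filter_upwards [Ioo_mem_nhds hτ.1 hτ.2] with t ht
  rw [primitiveL_apply, projIcc_of_mem _ (Ioo_subset_Icc_self ht)]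

end Volterra

/-! ### Frobenius theorem for flat linear connections -/

section FlatConnection

open scoped unitInterval

variable {V Z E : Type*} [NormedAddCommGroup V] [NormedSpace ℝ V]
  [NormedAddCommGroup Z] [NormedSpace ℝ Z]
  [NormedAddCommGroup E] [NormedSpace ℝ E]

/-- The radial component of a connection form, along the segment from `0` to `x`. -/
noncomputable def radialForm (A : V → V →L[ℝ] Z) (hA : ContDiff ℝ 1 A) (x : V) :
    C(I, Z) :=
  ⟨fun t => A ((t : ℝ) • x) x, by
    have := hA.continuous
    fun_prop⟩

/-- The derivative of the coefficient of `radialForm` in the base point. -/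
noncomputable def radialFormDeriv (A : V → V →L[ℝ] Z) (hA : ContDiff ℝ 1 A) :
    C(V, C(I, V →L[ℝ] Z)) :=
  -- Currying turns joint continuity in (x, t) into continuity in x for the uniform norm, as
  -- `ContinuousMap.hasFDerivAt_of_forall_eval` requires.
  ContinuousMap.curry ⟨fun p : V × I =>
    (p.2 : ℝ) • (fderiv ℝ A ((p.2 : ℝ) • p.1)).flip p.1 + A ((p.2 : ℝ) • p.1), by
    have h0 := hA.continuous
    have h1 := hA.continuous_fderiv one_ne_zero
    have h2 : Continuous fun p : V × I => (fderiv ℝ A ((p.2 : ℝ) • p.1)).flip :=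
      (ContinuousLinearMap.flipₗᵢ ℝ V V Z).continuous.comp (h1.comp (by fun_prop))
    fun_prop⟩

theorem radialFormDeriv_apply (A : V → V →L[ℝ] Z) (hA : ContDiff ℝ 1 A) (x v : V) (t : I) :
    radialFormDeriv A hA x t v =
      (t : ℝ) • fderiv ℝ A ((t : ℝ) • x) v x + A ((t : ℝ) • x) v := rfl

theorem hasFDerivAt_radialForm (A : V → V →L[ℝ] Z) (hA : ContDiff ℝ 1 A) (x : V) :
    HasFDerivAt (radialForm A hA)
      ((ContinuousMap.bilinearL I (ContinuousLinearMap.id ℝ (V →L[ℝ] Z))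
        (radialFormDeriv A hA x)).comp (ContinuousMap.constCLM I V)) x := by
  refine ContinuousMap.hasFDerivAt_of_forall_eval
    (F' := fun x => (ContinuousMap.bilinearL I (ContinuousLinearMap.id ℝ (V →L[ℝ] Z))
        (radialFormDeriv A hA x)).comp (ContinuousMap.constCLM I V)) ?_ (fun x t => ?_) x
  · have h := (radialFormDeriv A hA).continuous
    have h2 := (ContinuousMap.bilinearL I
      (ContinuousLinearMap.id ℝ (V →L[ℝ] Z))).continuous.comp h
    exact h2.clm_comp continuous_const
  · have h1 : HasFDerivAt (fun y : V => A ((t : ℝ) • y))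
        ((fderiv ℝ A ((t : ℝ) • x)).comp ((t : ℝ) • ContinuousLinearMap.id ℝ V)) x :=
      ((hA.differentiable one_ne_zero) _).hasFDerivAt.comp x
        ((hasFDerivAt_id x).const_smul (t : ℝ))
    have h2 := h1.clm_apply (hasFDerivAt_id x)
    refine h2.congr_fderiv ?_
    ext v
    simp [radialFormDeriv_apply, add_comm]

/-- The integral operator whose fixed points are the radially parallel sections. -/
noncomputable def radialOperator (L : Z →L[ℝ] E →L[ℝ] E) :
    C(I, Z) →L[ℝ] C(I, E) →L[ℝ] C(I, E) :=
  (ContinuousLinearMap.compL ℝ C(I, E) C(I, E) C(I, E) (primitiveL E)).comp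
    (ContinuousMap.bilinearL I L)

theorem radialOperator_apply (L : Z →L[ℝ] E →L[ℝ] E) (B : C(I, Z)) (f : C(I, E)) :
    radialOperator L B f = primitiveL E (ContinuousMap.bilinearL I L B f) := rfl

/-- Q is the expected derivative, in the direction v of the base point, of the radially parallel
curve S. By the product rule, Q' contains the derivative of A(v) along x; flatness trades it for the
derivative of A(x) along v and reverses the order of the two factors A(x), A(v). What results is the
differentiated fixed point equation. -/
theorem radialOperator_variation [CompleteSpace E] (L : Z →L[ℝ] E →L[ℝ] E) (A : V → V →L[ℝ] Z)
    (hA : ContDiff ℝ 1 A) {x : V}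
    (hflat : ∀ t ∈ Ioo (0 : ℝ) 1, ∀ v w e,
      L (fderiv ℝ A (t • x) v w) e + L (A (t • x) w) (L (A (t • x) v) e)
        = L (fderiv ℝ A (t • x) w v) e + L (A (t • x) v) (L (A (t • x) w) e))
    (v : V) {S : C(I, E)} {s₀ : E}
    (hS : S - radialOperator L (radialForm A hA x) S = ContinuousMap.constCLM I E s₀)
    (Q : C(I, E)) (hQ : ∀ t : I, Q t = (t : ℝ) • L (A ((t : ℝ) • x) v) (S t)) :
    Q - radialOperator L (radialForm A hA x) Q = radialOperator L
      (ContinuousMap.bilinearL I (ContinuousLinearMap.id ℝ (V →L[ℝ] Z))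
        (radialFormDeriv A hA x) (ContinuousMap.constCLM I V v)) S := by
  rw [sub_eq_iff_eq_add, radialOperator_apply, radialOperator_apply, ← map_add]
  ext t
  let q : ℝ → E := fun τ => τ • L (A (τ • x) v) (S (projIcc 0 1 zero_le_one τ))
  have hqQ : Q t = q t := by simp [q, hQ]
  rw [hqQ]
  symm
  refine primitiveL_eq_of_hasDerivAt ?_ (by simp [q]) (fun τ hτ => ?_) t
  · have h0 := hA.continuous
    have h1 := continuous_comp_projIcc S
    fun_prop
  · have hSτ : HasDerivAt (fun τ : ℝ => S (projIcc 0 1 zero_le_one τ))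
        (L (A (τ • x) x) (S ⟨τ, Ioo_subset_Icc_self hτ⟩)) τ := by
      have h := (hasDerivAt_primitiveL (ContinuousMap.bilinearL I L
        (radialForm A hA x) S) hτ).const_add s₀
      refine h.congr_of_eventuallyEq (Filter.Eventually.of_forall fun τ' => ?_)
      rw [sub_eq_iff_eq_add, radialOperator_apply] at hS
      exact congrArg (fun f : C(I, E) => f (projIcc 0 1 zero_le_one τ')) hS
    have hx : HasDerivAt (fun τ : ℝ => τ • x) x τ := by
      simpa using (hasDerivAt_id τ).smul_const x
    have hAτ : HasDerivAt (fun τ : ℝ => A (τ • x)) (fderiv ℝ A (τ • x) x) τ :=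
      ((hA.differentiable one_ne_zero) (τ • x)).hasFDerivAt.comp_hasDerivAt τ hx
    have hLA : HasDerivAt (fun τ : ℝ => L (A (τ • x) v)) (L (fderiv ℝ A (τ • x) x v)) τ := by
      have hAv : HasDerivAt (fun τ : ℝ => A (τ • x) v) (fderiv ℝ A (τ • x) x v) τ :=
        (hAτ.clm_apply (hasDerivAt_const τ v)).congr_deriv (by simp)
      exact L.hasFDerivAt.comp_hasDerivAt τ hAv
    have h : HasDerivAt q _ τ := (hasDerivAt_id τ).smul (hLA.clm_apply hSτ)
    refine h.congr_deriv ?_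
    have hf := hflat τ hτ x v (S ⟨τ, Ioo_subset_Icc_self hτ⟩)
    have hp : projIcc (0 : ℝ) 1 zero_le_one τ = ⟨τ, Ioo_subset_Icc_self hτ⟩ :=
      projIcc_of_mem _ _
    have hR : radialForm A hA x ⟨τ, Ioo_subset_Icc_self hτ⟩ = A (τ • x) x := rfl
    simp only [hp, id_eq, one_smul, ContinuousMap.add_apply, ContinuousMap.bilinearL_apply,
      ContinuousLinearMap.id_apply, radialFormDeriv_apply, ContinuousMap.constCLM_apply, hQ, hR,
      map_add, map_smul, add_apply, smul_apply]
    rw [hf, smul_add]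
    abel

/-- **Frobenius theorem for flat linear connections**: parallel sections with arbitrary initial
value exist near the origin. -/
theorem exists_parallel_section [CompleteSpace E] (L : Z →L[ℝ] E →L[ℝ] E) (A : V → V →L[ℝ] Z)
    (hA : ContDiff ℝ 1 A) {r : ℝ} (hr : 0 < r)
    (hflat : ∀ x ∈ Metric.ball (0 : V) r, ∀ v w e,
      L (fderiv ℝ A x v w) e + L (A x w) (L (A x v) e)
        = L (fderiv ℝ A x w v) e + L (A x v) (L (A x w) e)) :
    ∃ δ > 0, ∀ s₀ : E, ∃ s : V → E, s 0 = s₀ ∧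
      ∀ x ∈ Metric.ball (0 : V) δ, HasFDerivAt s ((L.flip (s x)).comp (A x)) x := by
  -- S = s₀ + T x S is the integrated form of radial transport from 0 to x, and T 0 = 0 makes 1 - T
  -- x invertible for small x.
  let T : V → C(I, E) →L[ℝ] C(I, E) := fun x => radialOperator L (radialForm A hA x)
  let T' : V → V →L[ℝ] C(I, E) →L[ℝ] C(I, E) := fun x => (radialOperator L).comp
    ((ContinuousMap.bilinearL I (ContinuousLinearMap.id ℝ (V →L[ℝ] Z))
        (radialFormDeriv A hA x)).comp (ContinuousMap.constCLM I V))
  have hT : ∀ x, HasFDerivAt T (T' x) x := fun x =>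
    (radialOperator L).hasFDerivAt.comp x (hasFDerivAt_radialForm A hA x)
  have hTc : Continuous T := continuous_iff_continuousAt.2 fun x => (hT x).continuousAt
  have hT0 : T 0 = 0 := by
    have : radialForm A hA 0 = 0 := by
      ext t
      simp [radialForm]
    simp only [T, this, map_zero]
  have hsmall : ∀ᶠ x in 𝓝 (0 : V), ‖T x‖ < 1 := by
    have := hTc.norm.tendsto' 0 0 (by simp [hT0])
    exact this.eventually_lt_const one_pos
  obtain ⟨δ, hδ, hball⟩ := Metric.eventually_nhds_iff_ball.1 hsmall
  refine ⟨min δ r, lt_min hδ hr, fun s₀ => ?_⟩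
  let c : C(I, E) := ContinuousMap.constCLM I E s₀
  let S : V → C(I, E) := fun x => Ring.inverse (1 - T x) c
  have hunit : ∀ x ∈ Metric.ball (0 : V) δ, IsUnit (1 - T x) := fun x hx =>
    isUnit_one_sub_of_norm_lt_one (hball x hx)
  have hS : ∀ x ∈ Metric.ball (0 : V) δ, S x - T x (S x) = c := fun x hx =>
    congrArg (fun J : C(I, E) →L[ℝ] C(I, E) => J c) (Ring.mul_inverse_cancel _ (hunit x hx))
  have hSd : ∀ x ∈ Metric.ball (0 : V) δ, DifferentiableAt ℝ S x := by
    intro x hx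
    obtain ⟨u, hu⟩ := hunit x hx
    have h1 : DifferentiableAt ℝ Ring.inverse (1 - T x) := by
      rw [← hu]
      exact (hasFDerivAt_ringInverse u).differentiableAt
    have h2 : DifferentiableAt ℝ (fun x => 1 - T x) x :=
      (hT x).differentiableAt.const_sub 1
    exact (h1.comp x h2).clm_apply (differentiableAt_const c)
  refine ⟨fun x => S x 1, ?_, fun x hx => ?_⟩
  · have := hS 0 (Metric.mem_ball_self hδ)
    rw [hT0] at this
    simpa [c] using congrArg (fun f : C(I, E) => f 1) this
  · have hxδ : x ∈ Metric.ball (0 : V) δ := Metric.ball_subset_ball (min_le_left _ _) hx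
    have hxr : x ∈ Metric.ball (0 : V) r := Metric.ball_subset_ball (min_le_right _ _) hx
    have hSx := (hSd x hxδ).hasFDerivAt
    -- Differentiate the constant S - T S = c by the product rule.
    have heq : ∀ v, fderiv ℝ S x v - T x (fderiv ℝ S x v) = T' x v (S x) := by
      intro v
      have h1 := hSx.sub ((hT x).clm_apply hSx)
      have h2 : HasFDerivAt (fun y => S y - T y (S y)) (0 : V →L[ℝ] C(I, E)) x :=
        (hasFDerivAt_const c x).congr_of_eventuallyEq
          (by filter_upwards [Metric.isOpen_ball.mem_nhds hxδ] with y hy using hS y hy)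
      have h3 := congrArg (fun J : V →L[ℝ] C(I, E) => J v) (h1.unique h2)
      simp only [sub_apply, add_apply,
        ContinuousLinearMap.comp_apply, ContinuousLinearMap.flip_apply,
        zero_apply] at h3
      rw [← sub_eq_zero, ← h3]
      abel
    have hmain : ∀ v, fderiv ℝ S x v 1 = L (A x v) (S x 1) := by
      intro v
      let Q : C(I, E) := ⟨fun t => (t : ℝ) • L (A ((t : ℝ) • x) v) (S x t), by
        have h0 := hA.continuous
        fun_prop⟩
      have hQ := radialOperator_variation L A hA (x := x) (fun t ht => hflat _ (by
        rw [mem_ball_zero_iff] at hxr ⊢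
        rw [norm_smul, Real.norm_of_nonneg ht.1.le]
        exact (mul_le_of_le_one_left (norm_nonneg _) ht.2.le).trans_lt hxr)) v (hS x hxδ) Q
        fun t => rfl
      -- The derivative of S and Q solve the same linear equation, and 1 - T x is invertible;
      -- evaluation at t = 1 then gives parallelism.
      have hinj : fderiv ℝ S x v = Q := by
        have h1 : (1 - T x : C(I, E) →L[ℝ] C(I, E)) (fderiv ℝ S x v)
            = (1 - T x : C(I, E) →L[ℝ] C(I, E)) Q := (heq v).trans hQ.symm
        have h2 := Ring.inverse_mul_cancel _ (hunit x hxδ)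
        have h3 := congrArg (Ring.inverse (1 - T x) : C(I, E) →L[ℝ] C(I, E)) h1
        have h4 : ∀ f : C(I, E), (Ring.inverse (1 - T x) : C(I, E) →L[ℝ] C(I, E))
            ((1 - T x : C(I, E) →L[ℝ] C(I, E)) f) = f := fun f =>
          congrArg (fun J : C(I, E) →L[ℝ] C(I, E) => J f) h2
        rwa [h4, h4] at h3
      rw [hinj]
      simp [Q]
    refine ((ContinuousMap.evalCLM ℝ (1 : I)).hasFDerivAt.comp x hSx).congr_fderiv ?_
    ext v
    exact hmain v

end FlatConnection

/-! ### Regularity of parallel sections, and cutoffs -/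

section SmoothSections

variable {V Z E : Type*} [NormedAddCommGroup V] [NormedSpace ℝ V]
  [NormedAddCommGroup Z] [NormedSpace ℝ Z] [NormedAddCommGroup E] [NormedSpace ℝ E]

/-- Bootstrap: the derivative is a smooth expression in x and s, so each order of differentiability
of s yields the next. -/
theorem contDiffOn_of_hasFDerivAt_parallel {L : Z →L[ℝ] E →L[ℝ] E} {A : V → V →L[ℝ] Z}
    (hA : ContDiff ℝ ∞ A) {U : Set V} (hU : IsOpen U) {s : V → E}
    (hs : ∀ x ∈ U, HasFDerivAt s ((L.flip (s x)).comp (A x)) x) : ContDiffOn ℝ ∞ s U := by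
  rw [contDiffOn_infty]
  intro n
  induction n with
  | zero => exact contDiffOn_zero.2 fun x hx => (hs x hx).continuousAt.continuousWithinAt
  | succ n ih =>
    have : ((n + 1 : ℕ) : ℕ∞ω) = (n : ℕ∞ω) + 1 := by norm_cast
    rw [this, contDiffOn_succ_iff_fderiv_of_isOpen hU]
    refine ⟨fun x hx => (hs x hx).differentiableAt.differentiableWithinAt, by simp, ?_⟩
    have hAn : ContDiff ℝ n A := hA.of_le (by exact_mod_cast le_top)
    refine ContDiffOn.congr (f := fun x => (L.flip (s x)).comp (A x)) ?_
      fun x hx => (hs x hx).fderiv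
    exact (L.flip.contDiff.comp_contDiffOn ih).clm_comp hAn.contDiffOn

theorem contDiff_smul_of_tsupport_subset {n : ℕ∞ω} {χ : V → ℝ} {f : V → E} {U : Set V}
    (hU : IsOpen U) (hχ : ContDiff ℝ n χ) (hsupp : tsupport χ ⊆ U) (hf : ContDiffOn ℝ n f U) :
    ContDiff ℝ n fun x => χ x • f x := by
  rw [contDiff_iff_contDiffAt]
  intro x
  by_cases hx : x ∈ U
  · exact hχ.contDiffAt.smul (hf.contDiffAt (hU.mem_nhds hx))
  · have h0 : (fun x => χ x • f x) =ᶠ[𝓝 x] fun _ => 0 := by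
      filter_upwards [notMem_tsupport_iff_eventuallyEq.1 fun h => hx (hsupp h)] with y hy
      simp [hy]
    exact contDiffAt_const.congr_of_eventuallyEq h0

end SmoothSections

/-! ### Integrable linear systems on the plane -/

theorem plane_eq_sum (v : Plane) :
    v = v 0 • EuclideanSpace.single 0 (1 : ℝ) + v 1 • EuclideanSpace.single 1 (1 : ℝ) := by
  ext i
  fin_cases i <;> simp

theorem fderiv_eq_partialDeriv (F : Plane → ℝ) (u v : Plane) :
    fderiv ℝ F u v = v 0 * partialDeriv 0 F u + v 1 * partialDeriv 1 F u := by
  conv_lhs => rw [plane_eq_sum v]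
  simp [partialDeriv]

section MatrixConnection

variable {n : ℕ}

/-- The connection form on the plane with the given matrices of coefficients. -/
noncomputable def matrixConnection (m : Fin 2 → Fin n → Fin n → Plane → ℝ) (x : Plane) :
    Plane →L[ℝ] (Fin n → ℝ) →L[ℝ] (Fin n → ℝ) :=
  ∑ i, ∑ a, ∑ b, m i a b x • (EuclideanSpace.proj i : Plane →L[ℝ] ℝ).smulRight
    ((ContinuousLinearMap.proj b : (Fin n → ℝ) →L[ℝ] ℝ).smulRight (Pi.single a (1 : ℝ)))

theorem matrixConnection_apply (m : Fin 2 → Fin n → Fin n → Plane → ℝ) (x w : Plane)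
    (e : Fin n → ℝ) (a : Fin n) :
    matrixConnection m x w e a = ∑ i, w i * ∑ b, m i a b x * e b := by
  simp [matrixConnection, Finset.sum_apply, Pi.single_apply, Finset.mul_sum]
  ring_nf
  congr 1 <;> exact Finset.sum_congr rfl fun _ _ => by ring

theorem fderiv_matrixConnection_apply {m : Fin 2 → Fin n → Fin n → Plane → ℝ}
    (hm : ∀ i a b, Differentiable ℝ (m i a b)) (x v w : Plane) (e : Fin n → ℝ) (a : Fin n) :
    fderiv ℝ (matrixConnection m) x v w e a
      = ∑ i, w i * ∑ b, fderiv ℝ (m i a b) x v * e b := by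
  have h : HasFDerivAt (matrixConnection m) (∑ i, ∑ a, ∑ b, (fderiv ℝ (m i a b) x).smulRight
      ((EuclideanSpace.proj i : Plane →L[ℝ] ℝ).smulRight
      ((ContinuousLinearMap.proj b : (Fin n → ℝ) →L[ℝ] ℝ).smulRight (Pi.single a (1 : ℝ))))) x := by
    refine HasFDerivAt.fun_sum fun i _ => HasFDerivAt.fun_sum fun a _ =>
      HasFDerivAt.fun_sum fun b _ => ?_
    exact (hm i a b x).hasFDerivAt.smul_const _
  rw [h.fderiv]
  have := matrixConnection_apply (fun i a b (_ : Plane) => fderiv ℝ (m i a b) x v) x w e a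
  rw [← this]
  simp [matrixConnection]

theorem contDiff_matrixConnection {m : Fin 2 → Fin n → Fin n → Plane → ℝ}
    (hm : ∀ i a b, ContDiff ℝ ∞ (m i a b)) : ContDiff ℝ ∞ (matrixConnection m) := by
  unfold matrixConnection
  exact ContDiff.sum fun i _ => ContDiff.sum fun a _ => ContDiff.sum fun b _ =>
    (hm i a b).smul contDiff_const

theorem exists_parallel_of_contDiff {m : Fin 2 → Fin n → Fin n → Plane → ℝ}
    (hm : ∀ i a b, ContDiff ℝ ∞ (m i a b)) {r : ℝ} (hr : 0 < r)
    (hflat : ∀ x ∈ Metric.ball (0 : Plane) r, ∀ a b,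
      partialDeriv 0 (m 1 a b) x + ∑ c, m 1 a c x * m 0 c b x
        = partialDeriv 1 (m 0 a b) x + ∑ c, m 0 a c x * m 1 c b x) :
    ∃ δ > 0, ∀ s₀ : Fin n → ℝ, ∃ s : Plane → Fin n → ℝ, s 0 = s₀ ∧
      ContDiffOn ℝ ∞ s (Metric.ball 0 δ) ∧
      ∀ x ∈ Metric.ball (0 : Plane) δ, ∀ i a,
        partialDeriv i (fun y => s y a) x = ∑ b, m i a b x * s x b := by
  have hmd : ∀ i a b, Differentiable ℝ (m i a b) := fun i a b =>
    (hm i a b).differentiable (by simp)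
  have hA := contDiff_matrixConnection hm
  obtain ⟨δ, hδ, h⟩ := exists_parallel_section (E := Fin n → ℝ)
    (ContinuousLinearMap.id ℝ ((Fin n → ℝ) →L[ℝ] (Fin n → ℝ)))
    (matrixConnection m) (hA.of_le (by exact_mod_cast le_top)) hr (by
      intro x hx v w e
      ext a
      have hPQ : (∑ b, partialDeriv 0 (m 1 a b) x * e b)
            + ∑ b, m 1 a b x * ∑ c, m 0 b c x * e c
          = (∑ b, partialDeriv 1 (m 0 a b) x * e b)
            + ∑ b, m 0 a b x * ∑ c, m 1 b c x * e c := by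
        have hQ : ∀ i j, ∑ b, m i a b x * ∑ c, m j b c x * e c
            = ∑ b, (∑ c, m i a c x * m j c b x) * e b := by
          intro i j
          simp only [Finset.mul_sum, Finset.sum_mul]
          rw [Finset.sum_comm]
          simp only [mul_assoc]
        rw [hQ, hQ, ← Finset.sum_add_distrib, ← Finset.sum_add_distrib]
        refine Finset.sum_congr rfl fun b _ => ?_
        rw [← add_mul, ← add_mul, hflat x hx a b]
      have hD : ∀ (v : Plane) i, ∑ b, fderiv ℝ (m i a b) x v * e b
          = v 0 * (∑ b, partialDeriv 0 (m i a b) x * e b)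
            + v 1 * ∑ b, partialDeriv 1 (m i a b) x * e b := by
        intro v i
        rw [Finset.mul_sum, Finset.mul_sum, ← Finset.sum_add_distrib]
        refine Finset.sum_congr rfl fun b _ => ?_
        rw [fderiv_eq_partialDeriv]
        ring
      have hC : ∀ (v : Plane) i, ∑ b, m i a b x * ∑ j, v j * ∑ c, m j b c x * e c
          = v 0 * (∑ b, m i a b x * ∑ c, m 0 b c x * e c)
            + v 1 * ∑ b, m i a b x * ∑ c, m 1 b c x * e c := by
        intro v i
        rw [Finset.mul_sum, Finset.mul_sum, ← Finset.sum_add_distrib]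
        refine Finset.sum_congr rfl fun b _ => ?_
        rw [Fin.sum_univ_two]
        ring
      simp only [ContinuousLinearMap.id_apply, Pi.add_apply, fderiv_matrixConnection_apply hmd,
        matrixConnection_apply, hD, hC]
      rw [Fin.sum_univ_two, Fin.sum_univ_two, Fin.sum_univ_two, Fin.sum_univ_two]
      -- The flatness defect is alternating in (v, w), so the pair of basis vectors decides, with
      -- the 2×2 determinant of (v, w) as factor.
      linear_combination (v 0 * w 1 - v 1 * w 0) * hPQ)
  refine ⟨δ, hδ, fun s₀ => ?_⟩
  obtain ⟨s, hs0, hs⟩ := h s₀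
  refine ⟨s, hs0, contDiffOn_of_hasFDerivAt_parallel hA Metric.isOpen_ball hs, ?_⟩
  intro x hx i a
  have h1 := (hasFDerivAt_pi'.1 (hs x hx)) a
  rw [partialDeriv, h1.fderiv]
  change matrixConnection m x (EuclideanSpace.single i 1) (s x) a = _
  rw [matrixConnection_apply]
  fin_cases i <;> simp

/-- **Frobenius theorem for linear systems in the plane**: an integrable overdetermined system
`∂ᵢ s = Mᵢ s` has smooth local solutions with arbitrary initial value. -/
theorem exists_parallel {m : Fin 2 → Fin n → Fin n → Plane → ℝ} {W : Set Plane} (hW : IsOpen W)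
    {u₀ : Plane} (hu₀ : u₀ ∈ W) (hm : ∀ i a b, ContDiffOn ℝ ∞ (m i a b) W)
    (hflat : ∀ x ∈ W, ∀ a b,
      partialDeriv 0 (m 1 a b) x + ∑ c, m 1 a c x * m 0 c b x
        = partialDeriv 1 (m 0 a b) x + ∑ c, m 0 a c x * m 1 c b x) :
    ∃ δ > 0, Metric.ball u₀ δ ⊆ W ∧ ∀ s₀ : Fin n → ℝ, ∃ s : Plane → Fin n → ℝ, s u₀ = s₀ ∧
      ContDiffOn ℝ ∞ s (Metric.ball u₀ δ) ∧
      ∀ x ∈ Metric.ball u₀ δ, ∀ i a,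
        partialDeriv i (fun y => s y a) x = ∑ b, m i a b x * s x b := by
  obtain ⟨R, hR, hRW⟩ := Metric.isOpen_iff.1 hW u₀ hu₀
  -- The cutoff makes the coefficients global and smooth. It equals 1 on the ball of radius R/3, so
  -- there the system is unchanged and still flat.
  let χ : ContDiffBump (0 : Plane) := ⟨R / 3, R / 2, by positivity, by linarith⟩
  let W' : Set Plane := (fun x => u₀ + x) ⁻¹' W
  have hW' : IsOpen W' := hW.preimage (by fun_prop)
  have hball : ∀ x ∈ Metric.ball (0 : Plane) R, x ∈ W' := fun x hx => hRW (by
    simpa [Metric.mem_ball, dist_eq_norm] using hx)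
  have hχ : tsupport χ ⊆ W' := by
    rw [χ.tsupport_eq]
    exact fun x hx => hball x (Metric.closedBall_subset_ball (by simp only [χ]; linarith) hx)
  let m' : Fin 2 → Fin n → Fin n → Plane → ℝ := fun i a b x => χ x • m i a b (u₀ + x)
  have hm' : ∀ i a b, ContDiff ℝ ∞ (m' i a b) := fun i a b =>
    contDiff_smul_of_tsupport_subset hW' χ.contDiff hχ
      ((hm i a b).comp (by fun_prop) fun x hx => hx)
  have heq : ∀ x ∈ Metric.ball (0 : Plane) (R / 3), ∀ i a b,
      m' i a b =ᶠ[𝓝 x] fun y => m i a b (u₀ + y) := by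
    intro x hx i a b
    filter_upwards [χ.eventuallyEq_one_of_mem_ball hx] with y hy
    simp [m', hy]
  have hpd : ∀ x ∈ Metric.ball (0 : Plane) (R / 3), ∀ i j a b,
      partialDeriv j (m' i a b) x = partialDeriv j (m i a b) (u₀ + x) := by
    intro x hx i j a b
    rw [partialDeriv, (heq x hx i a b).fderiv_eq, fderiv_comp_add_left, partialDeriv]
  obtain ⟨δ, hδ, h⟩ := exists_parallel_of_contDiff hm' (r := R / 3) (by positivity) (by
    intro x hx a b
    have h1 : ∀ i a b, m' i a b x = m i a b (u₀ + x) := fun i a b => (heq x hx i a b).eq_of_nhds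
    simp only [hpd x hx, h1]
    exact hflat _ (hball x (Metric.ball_subset_ball (by linarith) hx)) a b)
  have hsub : ∀ x ∈ Metric.ball u₀ (min δ (R / 3)),
      x - u₀ ∈ Metric.ball (0 : Plane) δ ∧ x - u₀ ∈ Metric.ball (0 : Plane) (R / 3) := by
    intro x hx
    rw [Metric.mem_ball, dist_eq_norm, lt_min_iff] at hx
    simpa [Metric.mem_ball] using hx
  refine ⟨min δ (R / 3), by positivity, fun x hx => ?_, fun s₀ => ?_⟩
  · have := hball _ (Metric.ball_subset_ball (by linarith) (hsub x hx).2)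
    simpa [W'] using this
  obtain ⟨s, hs0, hs1, hs2⟩ := h s₀
  refine ⟨fun x => s (x - u₀), by simpa using hs0,
    hs1.comp (by fun_prop) fun x hx => (hsub x hx).1, fun x hx i a => ?_⟩
  have h1 : ∀ i a b, m' i a b (x - u₀) = m i a b x := fun i a b => by
    simpa using (heq _ (hsub x hx).2 i a b).eq_of_nhds
  have h2 := hs2 _ (hsub x hx).1 i a
  simp only [h1] at h2
  rw [← h2, partialDeriv, partialDeriv, ← fderiv_comp_sub]

end MatrixConnection

/-! ### Partial derivatives and symmetries of curvature -/

section PartialDerivCalculus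

variable {F H : Plane → ℝ} {u : Plane} (i j : Fin 2)

theorem partialDeriv_add (hF : DifferentiableAt ℝ F u) (hH : DifferentiableAt ℝ H u) :
    partialDeriv i (fun v => F v + H v) u = partialDeriv i F u + partialDeriv i H u := by
  simp only [partialDeriv]
  rw [fderiv_fun_add hF hH]
  rfl

theorem partialDeriv_mul (hF : DifferentiableAt ℝ F u) (hH : DifferentiableAt ℝ H u) :
    partialDeriv i (fun v => F v * H v) u
      = partialDeriv i F u * H u + F u * partialDeriv i H u := by
  simp only [partialDeriv]
  rw [fderiv_fun_mul hF hH]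
  simp
  ring

theorem partialDeriv_const (c : ℝ) : partialDeriv i (fun _ => c) u = 0 := by
  simp [partialDeriv]

theorem partialDeriv_const_mul (c : ℝ) (hF : DifferentiableAt ℝ F u) :
    partialDeriv i (fun v => c * F v) u = c * partialDeriv i F u := by
  rw [partialDeriv_mul i (differentiableAt_const c) hF, partialDeriv_const]
  ring

theorem partialDeriv_congr (h : F =ᶠ[𝓝 u] H) : partialDeriv i F u = partialDeriv i H u := by
  rw [partialDeriv, h.fderiv_eq, partialDeriv]

theorem ContDiffOn.partialDeriv {W : Set Plane} (hW : IsOpen W) (hF : ContDiffOn ℝ ∞ F W) :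
    ContDiffOn ℝ ∞ (partialDeriv i F) W :=
  (((contDiffOn_infty_iff_fderiv_of_isOpen hW).1 hF).2).clm_apply contDiffOn_const

theorem partialDeriv_comm {W : Set Plane} (hW : IsOpen W) (hF : ContDiffOn ℝ ∞ F W) (hu : u ∈ W) :
    partialDeriv i (partialDeriv j F) u = partialDeriv j (partialDeriv i F) u := by
  have hFu : ContDiffAt ℝ 2 F u :=
    contDiffAt_infty.1 (hF.contDiffAt (hW.mem_nhds hu)) 2
  have hd : DifferentiableAt ℝ (fderiv ℝ F) u :=
    (hFu.fderiv_right (m := 1) (by norm_num)).differentiableAt one_ne_zero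
  have hs : IsSymmSndFDerivAt ℝ F u := hFu.isSymmSndFDerivAt (by simp)
  have h : ∀ i j, partialDeriv i (partialDeriv j F) u
      = fderiv ℝ (fderiv ℝ F) u (EuclideanSpace.single i 1) (EuclideanSpace.single j 1) := by
    intro i j
    simp only [partialDeriv]
    have : HasFDerivAt (fun v => fderiv ℝ F v (EuclideanSpace.single j 1)) _ u :=
      hd.hasFDerivAt.clm_apply (hasFDerivAt_const (EuclideanSpace.single j (1 : ℝ)) u)
    rw [show _root_.partialDeriv j F = fun v => fderiv ℝ F v (EuclideanSpace.single j 1) from rfl,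
      this.fderiv]
    simp
  rw [h, h, hs.eq]

end PartialDerivCalculus

/-- The curvature of a connection compatible with a bilinear form is skew-adjoint. -/
theorem curvature_skew {γ : Fin 2 → Fin 2 → Plane → ℝ} {Γ : Fin 2 → Fin 2 → Fin 2 → Plane → ℝ}
    {W : Set Plane} (hW : IsOpen W) (hγ : ∀ i j, ContDiffOn ℝ ∞ (γ i j) W)
    (hΓ : ∀ k i j, ContDiffOn ℝ ∞ (Γ k i j) W)
    (hcompat : ∀ u ∈ W, ∀ m i j, partialDeriv m (γ i j) u
      = ∑ k, (γ k j u * Γ k m i u + γ i k u * Γ k m j u)) {u : Plane} (hu : u ∈ W)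
    {R : Fin 2 → Fin 2 → ℝ} (hR : ∀ l k, R l k = partialDeriv 0 (Γ l 1 k) u
      - partialDeriv 1 (Γ l 0 k) u + ∑ m, (Γ l 0 m u * Γ m 1 k u - Γ l 1 m u * Γ m 0 k u))
    (i j : Fin 2) : ∑ l, γ l j u * R l i + ∑ l, γ i l u * R l j = 0 := by
  have hγd : ∀ i j, DifferentiableAt ℝ (γ i j) u := fun i j =>
    ((hγ i j).contDiffAt (hW.mem_nhds hu)).differentiableAt (by simp)
  have hΓd : ∀ k i j, DifferentiableAt ℝ (Γ k i j) u := fun k i j =>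
    ((hΓ k i j).contDiffAt (hW.mem_nhds hu)).differentiableAt (by simp)
  have h2 : ∀ n m, partialDeriv n (partialDeriv m (γ i j)) u
      = ((partialDeriv n (γ 0 j) u * Γ 0 m i u + γ 0 j u * partialDeriv n (Γ 0 m i) u)
        + (partialDeriv n (γ i 0) u * Γ 0 m j u + γ i 0 u * partialDeriv n (Γ 0 m j) u))
        + ((partialDeriv n (γ 1 j) u * Γ 1 m i u + γ 1 j u * partialDeriv n (Γ 1 m i) u)
        + (partialDeriv n (γ i 1) u * Γ 1 m j u + γ i 1 u * partialDeriv n (Γ 1 m j) u)) := by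
    intro n m
    -- Compatibility holds near u, so it may be differentiated once more; the symmetry of second
    -- derivatives of γ then gives the claim.
    have he : partialDeriv m (γ i j) =ᶠ[𝓝 u] fun v =>
        (γ 0 j v * Γ 0 m i v + γ i 0 v * Γ 0 m j v)
        + (γ 1 j v * Γ 1 m i v + γ i 1 v * Γ 1 m j v) := by
      filter_upwards [hW.mem_nhds hu] with v hv
      rw [hcompat v hv, Fin.sum_univ_two]
    have hp : ∀ a b k m l, DifferentiableAt ℝ (fun v => γ a b v * Γ k m l v) u :=
      fun a b k m l => (hγd a b).mul (hΓd k m l)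
    rw [partialDeriv_congr n he, partialDeriv_add n ((hp _ _ _ _ _).fun_add (hp _ _ _ _ _))
      ((hp _ _ _ _ _).fun_add (hp _ _ _ _ _)), partialDeriv_add n (hp _ _ _ _ _) (hp _ _ _ _ _),
      partialDeriv_add n (hp _ _ _ _ _) (hp _ _ _ _ _)]
    simp only [partialDeriv_mul n (hγd _ _) (hΓd _ _ _)]
  have h3 := partialDeriv_comm 0 1 hW (hγ i j) hu
  rw [h2, h2] at h3
  simp only [hcompat u hu, Fin.sum_univ_two] at h3
  simp only [hR, Fin.sum_univ_two]
  linear_combination h3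

/-! ### The system Hess f = -K f g in constant curvature -/

section LocalConnection

/-- The inverse metric of two covectors, multiplied by the determinant of the metric `γ`. -/
def adjugateForm (γ : Fin 2 → Fin 2 → ℝ) (α β : Fin 2 → ℝ) : ℝ :=
  γ 1 1 * α 0 * β 0 - γ 0 1 * (α 0 * β 1 + α 1 * β 0) + γ 0 0 * α 1 * β 1

/-- A Riemannian metric `γ` on an open set `W` of the plane, with a torsion-free compatible
connection `Γ`. -/
structure IsLocalConnection (W : Set Plane) (γ : Fin 2 → Fin 2 → Plane → ℝ)
    (Γ : Fin 2 → Fin 2 → Fin 2 → Plane → ℝ) : Prop where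
  isOpen : IsOpen W
  smooth : ∀ i j, ContDiffOn ℝ ∞ (γ i j) W
  smooth_connection : ∀ k i j, ContDiffOn ℝ ∞ (Γ k i j) W
  symm : ∀ u ∈ W, γ 1 0 u = γ 0 1 u
  pos : ∀ u ∈ W, 0 < γ 0 0 u
  det_pos : ∀ u ∈ W, 0 < γ 0 0 u * γ 1 1 u - γ 0 1 u * γ 0 1 u
  torsion : ∀ u ∈ W, ∀ k, Γ k 1 0 u = Γ k 0 1 u
  compat : ∀ u ∈ W, ∀ m i j, partialDeriv m (γ i j) u
      = ∑ k, (γ k j u * Γ k m i u + γ i k u * Γ k m j u)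

/-- The coefficients of the system `∂ᵢ f = αᵢ`, `∂ᵢ αⱼ = ∑ₖ Γᵏᵢⱼ αₖ - K f γᵢⱼ` for the unknown
`(f, α₀, α₁)`. -/
def hessianSystem (K : ℝ) (γ : Fin 2 → Fin 2 → Plane → ℝ)
    (Γ : Fin 2 → Fin 2 → Fin 2 → Plane → ℝ) (i : Fin 2) : Fin 3 → Fin 3 → Plane → ℝ :=
  ![![fun _ => 0, fun _ => if i = 0 then 1 else 0, fun _ => if i = 1 then 1 else 0],
    ![fun u => -K * γ i 0 u, Γ 0 i 0, Γ 1 i 0],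
    ![fun u => -K * γ i 1 u, Γ 0 i 1, Γ 1 i 1]]

variable {W : Set Plane} {γ : Fin 2 → Fin 2 → Plane → ℝ}
  {Γ : Fin 2 → Fin 2 → Fin 2 → Plane → ℝ}

theorem IsLocalConnection.differentiableAt (h : IsLocalConnection W γ Γ) {u : Plane} (hu : u ∈ W)
    (i j : Fin 2) : DifferentiableAt ℝ (γ i j) u :=
  ((h.smooth i j).contDiffAt (h.isOpen.mem_nhds hu)).differentiableAt (by simp)

/-- In dimension two skew-adjoint endomorphisms form a line, so K alone fixes the curvature: the
l-th component of R(∂₀, ∂₁)∂ₖ is K(δˡ₀ γ₁ₖ - δˡ₁ γ₀ₖ). -/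
theorem IsLocalConnection.riemann_eq (h : IsLocalConnection W γ Γ) {K : ℝ} {u : Plane}
    (hu : u ∈ W) {R : Fin 2 → Fin 2 → ℝ} (hR : ∀ l k, R l k = partialDeriv 0 (Γ l 1 k) u
      - partialDeriv 1 (Γ l 0 k) u + ∑ m, (Γ l 0 m u * Γ m 1 k u - Γ l 1 m u * Γ m 0 k u))
    (hK : ∑ l, γ 0 l u * R l 1 = K * (γ 0 0 u * γ 1 1 u - γ 0 1 u * γ 0 1 u)) :
    R 0 0 = K * γ 0 1 u ∧ R 1 0 = -K * γ 0 0 u ∧ R 0 1 = K * γ 1 1 u ∧ R 1 1 = -K * γ 0 1 u := by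
  have hskew := curvature_skew h.isOpen h.smooth h.smooth_connection h.compat hu hR
  have h00 := hskew 0 0
  have h01 := hskew 0 1
  have h11 := hskew 1 1
  have hD := (h.det_pos u hu).ne'
  simp only [Fin.sum_univ_two, h.symm u hu] at h00 h01 h11 hK
  -- Three skewness equations and the curvature equation are linear in the four unknowns R;
  -- multiplying by det γ permits elimination without division by the determinant.
  refine ⟨?_, ?_, ?_, ?_⟩ <;> apply mul_left_cancel₀ hD
  · linear_combination γ 1 1 u / 2 * h00 - γ 0 1 u * h01 + γ 0 1 u * hK
  · linear_combination -γ 0 1 u / 2 * h00 + γ 0 0 u * h01 - γ 0 0 u * hK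
  · linear_combination γ 1 1 u * hK - γ 0 1 u / 2 * h11
  · linear_combination -γ 0 1 u * hK + γ 0 0 u / 2 * h11

/-- The row of f is integrable because γ is symmetric and Γ torsion-free. In the rows of α, the
coefficients of f agree because γ is parallel and Γ torsion-free, and those of α by
`IsLocalConnection.riemann_eq`. -/
theorem IsLocalConnection.hessianSystem_flat (h : IsLocalConnection W γ Γ) {K : ℝ} {u : Plane}
    (hu : u ∈ W) {R : Fin 2 → Fin 2 → ℝ} (hR : ∀ l k, R l k = partialDeriv 0 (Γ l 1 k) u
      - partialDeriv 1 (Γ l 0 k) u + ∑ m, (Γ l 0 m u * Γ m 1 k u - Γ l 1 m u * Γ m 0 k u))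
    (hK : ∑ l, γ 0 l u * R l 1 = K * (γ 0 0 u * γ 1 1 u - γ 0 1 u * γ 0 1 u)) (a b : Fin 3) :
    partialDeriv 0 (hessianSystem K γ Γ 1 a b) u
        + ∑ c, hessianSystem K γ Γ 1 a c u * hessianSystem K γ Γ 0 c b u
      = partialDeriv 1 (hessianSystem K γ Γ 0 a b) u
        + ∑ c, hessianSystem K γ Γ 0 a c u * hessianSystem K γ Γ 1 c b u := by
  obtain ⟨h1, h2, h3, h4⟩ := h.riemann_eq hu hR hK
  have hT := h.torsion u hu
  rw [hR, Fin.sum_univ_two] at h1 h2 h3 h4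
  have hd := h.differentiableAt hu
  have hc := h.compat u hu
  have hs := h.symm u hu
  fin_cases a <;> fin_cases b <;>
    simp [hessianSystem, Fin.sum_univ_three, partialDeriv_const,
      partialDeriv_const_mul _ (-K) (hd _ _), -neg_mul, hT, hs] <;>
    first
    | (simp only [hc, Fin.sum_univ_two, hT, hs]; ring)
    | (simp only [hT] at h1 h2 h3 h4
       first
       | linear_combination h1
       | linear_combination h2
       | linear_combination h3
       | linear_combination h4)

theorem IsLocalConnection.contDiffOn_hessianSystem (h : IsLocalConnection W γ Γ) (K : ℝ)
    (i : Fin 2) (a b : Fin 3) : ContDiffOn ℝ ∞ (hessianSystem K γ Γ i a b) W := by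
  have h1 : ∀ j, ContDiffOn ℝ ∞ (fun u => -K * γ i j u) W := fun j =>
    contDiffOn_const.mul (h.smooth i j)
  have h2 := h.smooth_connection
  fin_cases a <;> fin_cases b <;> simp only [hessianSystem] <;>
    first
    | exact contDiffOn_const
    | exact h1 _
    | exact h2 _ _ _

theorem eq_of_partialDeriv_eq_zero {F : Plane → ℝ} {u₀ : Plane} {δ : ℝ} (hδ : 0 < δ)
    (hF : ∀ u ∈ Metric.ball u₀ δ, DifferentiableAt ℝ F u)
    (h0 : ∀ u ∈ Metric.ball u₀ δ, ∀ i, partialDeriv i F u = 0) {u : Plane}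
    (hu : u ∈ Metric.ball u₀ δ) : F u = F u₀ := by
  refine Metric.isOpen_ball.is_const_of_fderiv_eq_zero (𝕜 := ℝ)
    (convex_ball u₀ δ).isPreconnected
    (fun v hv => (hF v hv).differentiableWithinAt) (fun v hv => ?_) hu (Metric.mem_ball_self hδ)
  ext w
  simp [fderiv_eq_partialDeriv, h0 v hv]

/-- A solution of the overdetermined system `hessianSystem` on a ball. -/
structure IsHessianSolution (K : ℝ) (γ : Fin 2 → Fin 2 → Plane → ℝ)
    (Γ : Fin 2 → Fin 2 → Fin 2 → Plane → ℝ) (B : Set Plane) (s : Plane → Fin 3 → ℝ) : Prop where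
  smooth : ContDiffOn ℝ ∞ s B
  eq : ∀ u ∈ B, ∀ i a, partialDeriv i (fun y => s y a) u = ∑ b, hessianSystem K γ Γ i a b u * s u b

theorem IsHessianSolution.differentiableAt {K : ℝ} {B : Set Plane} {s : Plane → Fin 3 → ℝ}
    (hs : IsHessianSolution K γ Γ B s) (hB : IsOpen B) {u : Plane} (hu : u ∈ B) (a : Fin 3) :
    DifferentiableAt ℝ (fun y => s y a) u :=
  differentiableAt_pi.1 ((hs.smooth.contDiffAt (hB.mem_nhds hu)).differentiableAt (by simp)) a

/-- The function g⁻¹(ds, dt) + K s t is constant: Hess s = -K s g and Hess t = -K t g make its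
differential -K s dt - K t ds + K d(st) = 0. The constant is c; everything is multiplied by det γ to
avoid the inverse metric. -/
theorem IsLocalConnection.conserved (h : IsLocalConnection W γ Γ) {K : ℝ} {u₀ : Plane} {δ : ℝ}
    (hδ : 0 < δ) (hW : Metric.ball u₀ δ ⊆ W) {s t : Plane → Fin 3 → ℝ}
    (hs : IsHessianSolution K γ Γ (Metric.ball u₀ δ) s)
    (ht : IsHessianSolution K γ Γ (Metric.ball u₀ δ) t) {c : ℝ}
    (h0 : adjugateForm (fun i j => γ i j u₀) (fun i => s u₀ i.succ) (fun i => t u₀ i.succ)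
      = (c - K * s u₀ 0 * t u₀ 0) * (γ 0 0 u₀ * γ 1 1 u₀ - γ 0 1 u₀ * γ 0 1 u₀))
    {u : Plane} (hu : u ∈ Metric.ball u₀ δ) :
    adjugateForm (fun i j => γ i j u) (fun i => s u i.succ) (fun i => t u i.succ)
      = (c - K * s u 0 * t u 0) * (γ 0 0 u * γ 1 1 u - γ 0 1 u * γ 0 1 u) := by
  let D : Plane → ℝ := fun u => γ 0 0 u * γ 1 1 u - γ 0 1 u * γ 0 1 u
  let Y : Plane → ℝ := fun u => adjugateForm (fun i j => γ i j u) (fun i => s u i.succ)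
    (fun i => t u i.succ) + K * s u 0 * t u 0 * D u
  have hD : ∀ u ∈ Metric.ball u₀ δ, D u ≠ 0 := fun u hu => (h.det_pos u (hW hu)).ne'
  -- The relation Y' D = Y D' says that Y / D is constant.
  have key : ∀ u ∈ Metric.ball u₀ δ, ∃ D' Y' : Plane →L[ℝ] ℝ, HasFDerivAt D D' u ∧
      HasFDerivAt Y Y' u ∧ ∀ i : Fin 2,
        Y' (EuclideanSpace.single i 1) * D u = Y u * D' (EuclideanSpace.single i 1) := by
    intro u hu
    have hd := fun i j => (h.differentiableAt (hW hu) i j).hasFDerivAt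
    have hsd := fun a => (hs.differentiableAt Metric.isOpen_ball hu a).hasFDerivAt
    have htd := fun a => (ht.differentiableAt Metric.isOpen_ball hu a).hasFDerivAt
    have hD' : HasFDerivAt D _ u := ((hd 0 0).mul (hd 1 1)).sub ((hd 0 1).mul (hd 0 1))
    have hN' : HasFDerivAt (fun u => adjugateForm (fun i j => γ i j u) (fun i => s u i.succ)
        (fun i => t u i.succ)) _ u :=
      ((((hd 1 1).mul (hsd 1)).mul (htd 1)).sub ((hd 0 1).mul
        (((hsd 1).mul (htd 2)).add ((hsd 2).mul (htd 1))))).add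
        (((hd 0 0).mul (hsd 2)).mul (htd 2))
    have hY' : HasFDerivAt Y _ u := hN'.add ((((hsd 0).const_mul K).mul (htd 0)).mul hD')
    refine ⟨_, _, hD', hY', fun i => ?_⟩
    have e1 : ∀ a b, fderiv ℝ (γ a b) u (EuclideanSpace.single i 1)
        = ∑ k, (γ k b u * Γ k i a u + γ a k u * Γ k i b u) := fun a b =>
      h.compat u (hW hu) i a b
    have e2 : ∀ a, fderiv ℝ (fun y => s y a) u (EuclideanSpace.single i 1)
        = ∑ b, hessianSystem K γ Γ i a b u * s u b := hs.eq u hu i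
    have e3 : ∀ a, fderiv ℝ (fun y => t y a) u (EuclideanSpace.single i 1)
        = ∑ b, hessianSystem K γ Γ i a b u * t u b := ht.eq u hu i
    have hsym := h.symm u (hW hu)
    have hT := h.torsion u (hW hu)
    simp only [Y, D, adjugateForm, add_apply, sub_apply, smul_apply, smul_eq_mul, e1, e2, e3,
      Fin.sum_univ_two, Fin.sum_univ_three, Pi.mul_apply, Pi.add_apply]
    fin_cases i <;> simp [hessianSystem, hsym, hT] <;> ring
  have hquot := eq_of_partialDeriv_eq_zero (F := fun u => Y u / D u) hδ
    (fun u hu => by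
      obtain ⟨D', Y', h1, h2, -⟩ := key u hu
      simp only [div_eq_mul_inv]
      exact h2.differentiableAt.fun_mul
        ((hasDerivAt_inv (hD u hu)).comp_hasFDerivAt u h1).differentiableAt)
    (fun u hu i => by
      obtain ⟨D', Y', h1, h2, h3⟩ := key u hu
      have h4 : HasFDerivAt (fun u => Y u * (D u)⁻¹) _ u :=
        h2.mul ((hasDerivAt_inv (hD u hu)).comp_hasFDerivAt u h1)
      simp only [div_eq_mul_inv, partialDeriv]
      rw [h4.fderiv]
      have h5 := hD u hu
      simp
      field_simp
      linear_combination h3 i) hu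
  have hY0 : Y u₀ = c * D u₀ := by
    simp only [Y, D, h0]
    ring
  have h5 : Y u = c * D u := by
    have h6 := hD u hu
    have h7 := hD u₀ (Metric.mem_ball_self hδ)
    rw [hY0, mul_div_cancel_right₀ _ h7, div_eq_iff h6] at hquot
    exact hquot
  simp only [Y] at h5
  linear_combination h5

end LocalConnection

/-! ### Isothermal functions by stereographic projection -/

section Isothermal

variable {W : Set Plane} {γ : Fin 2 → Fin 2 → Plane → ℝ}
  {Γ : Fin 2 → Fin 2 → Fin 2 → Plane → ℝ}

/-- A metric of constant curvature has isothermal functions: two functions whose differentials are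
orthogonal and of the same nonzero length. -/
theorem IsLocalConnection.exists_isothermal (h : IsLocalConnection W γ Γ) {K : ℝ}
    (hK : ∀ u ∈ W, ∑ l, γ 0 l u * (partialDeriv 0 (Γ l 1 1) u
      - partialDeriv 1 (Γ l 0 1) u + ∑ m, (Γ l 0 m u * Γ m 1 1 u - Γ l 1 m u * Γ m 0 1 u))
      = K * (γ 0 0 u * γ 1 1 u - γ 0 1 u * γ 0 1 u)) {u₀ : Plane} (hu₀ : u₀ ∈ W) :
    ∃ δ > 0, Metric.ball u₀ δ ⊆ W ∧ ∃ z : Fin 2 → Plane → ℝ, (∀ a, z a u₀ = 0) ∧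
      (∀ a, ContDiffOn ℝ ∞ (z a) (Metric.ball u₀ δ)) ∧ ∃ μ : Plane → ℝ,
        ∀ u ∈ Metric.ball u₀ δ, 0 < μ u ∧ ∀ a b,
          adjugateForm (fun i j => γ i j u) (fun k => partialDeriv k (z a) u)
            (fun k => partialDeriv k (z b) u) = if a = b then μ u else 0 := by
  obtain ⟨δ, hδ, hδW, hex⟩ := exists_parallel h.isOpen hu₀ (h.contDiffOn_hessianSystem K)
    fun u hu a b => h.hessianSystem_flat hu (fun _ _ => rfl) (hK u hu) a b
  set A := γ 0 0 u₀ with hA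
  set D := γ 0 0 u₀ * γ 1 1 u₀ - γ 0 1 u₀ * γ 0 1 u₀ with hD
  have hApos : 0 < A := h.pos u₀ hu₀
  have hDpos : 0 < D := h.det_pos u₀ hu₀
  -- The differentials of s and t at u₀ are the rows of the Cholesky factor of the metric, an
  -- orthonormal coframe. For K = 1 the solutions s, t, w model the linear coordinates restricted to
  -- the unit sphere, with u₀ as the pole w = 1.
  obtain ⟨s, hs0, hs1, hs2⟩ := hex ![0, √A, γ 0 1 u₀ / √A]
  obtain ⟨t, ht0, ht1, ht2⟩ := hex ![0, 0, √D / √A]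
  obtain ⟨w, hw0, hw1, hw2⟩ := hex ![1, 0, 0]
  have hs : IsHessianSolution K γ Γ (Metric.ball u₀ δ) s := ⟨hs1, hs2⟩
  have ht : IsHessianSolution K γ Γ (Metric.ball u₀ δ) t := ⟨ht1, ht2⟩
  have hw : IsHessianSolution K γ Γ (Metric.ball u₀ δ) w := ⟨hw1, hw2⟩
  have hsA : √A ≠ 0 := (Real.sqrt_pos.2 hApos).ne'
  have hA2 : √A ^ 2 = A := Real.sq_sqrt hApos.le
  have hD2 : √D ^ 2 = D := Real.sq_sqrt hDpos.le
  let X : Fin 2 → Plane → Fin 3 → ℝ := ![s, t]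
  have hX : ∀ a, IsHessianSolution K γ Γ (Metric.ball u₀ δ) (X a) := by
    intro a
    fin_cases a
    · exact hs
    · exact ht
  have hX0 : ∀ a, X a u₀ 0 = 0 := by
    intro a
    fin_cases a
    · simp [X, hs0]
    · simp [X, ht0]
  have hXX : ∀ a b, ∀ u ∈ Metric.ball u₀ δ, adjugateForm (fun i j => γ i j u)
      (fun i => X a u i.succ) (fun i => X b u i.succ)
      = ((if a = b then 1 else 0) - K * X a u 0 * X b u 0)
        * (γ 0 0 u * γ 1 1 u - γ 0 1 u * γ 0 1 u) := by
    intro a b u hu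
    refine h.conserved hδ hδW (hX a) (hX b) ?_ hu
    rw [hX0, hX0, ← hD, adjugateForm]
    fin_cases a <;> fin_cases b <;> simp [X, hs0, ht0, ← hA]
    · field_simp
      rw [hA2, hD]
      ring
    · field_simp
      rw [hA2]
      ring
    · field_simp
      rw [hA2]
      ring
    · field_simp
      rw [hA2, hD2]
  have hXw : ∀ a, ∀ u ∈ Metric.ball u₀ δ, adjugateForm (fun i j => γ i j u)
      (fun i => X a u i.succ) (fun i => w u i.succ)
      = (0 - K * X a u 0 * w u 0) * (γ 0 0 u * γ 1 1 u - γ 0 1 u * γ 0 1 u) := by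
    intro a u hu
    refine h.conserved hδ hδW (hX a) hw ?_ hu
    rw [hX0, adjugateForm]
    simp [hw0]
  have hww : ∀ u ∈ Metric.ball u₀ δ, adjugateForm (fun i j => γ i j u)
      (fun i => w u i.succ) (fun i => w u i.succ)
      = (K - K * w u 0 * w u 0) * (γ 0 0 u * γ 1 1 u - γ 0 1 u * γ 0 1 u) := by
    intro u hu
    refine h.conserved hδ hδW hw hw ?_ hu
    rw [adjugateForm]
    simp [hw0]
  have hpos : ∀ᶠ u in 𝓝 u₀, 0 < 1 + w u 0 := by
    have hc : ContinuousAt (fun u => 1 + w u 0) u₀ := continuousAt_const.add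
      (hw.differentiableAt Metric.isOpen_ball (Metric.mem_ball_self hδ) 0).continuousAt
    refine hc.eventually_const_lt ?_
    simp [hw0]
  obtain ⟨ε, hε, hball⟩ := Metric.eventually_nhds_iff_ball.1 hpos
  have hsub1 : Metric.ball u₀ (min δ ε) ⊆ Metric.ball u₀ δ :=
    Metric.ball_subset_ball (min_le_left _ _)
  have hsub2 : Metric.ball u₀ (min δ ε) ⊆ Metric.ball u₀ ε :=
    Metric.ball_subset_ball (min_le_right _ _)
  -- Stereographic projection from the point w = -1; for K = 0, w is identically 1 and each quotient
  -- is half a flat coordinate.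
  refine ⟨min δ ε, lt_min hδ hε, hsub1.trans hδW, fun a u => X a u 0 * (1 + w u 0)⁻¹,
    fun a => by simp [hX0], fun a => ?_, fun u =>
      (γ 0 0 u * γ 1 1 u - γ 0 1 u * γ 0 1 u) / (1 + w u 0) ^ 2, fun u hu => ⟨?_, fun a b => ?_⟩⟩
  · have h1 := (contDiffOn_pi.1 (hX a).smooth 0).mono hsub1
    have h2 := (contDiffOn_pi.1 hw.smooth 0).mono hsub1
    exact h1.mul ((contDiffOn_const.add h2).inv fun u hu => (hball u (hsub2 hu)).ne')
  · exact div_pos (h.det_pos u (hδW (hsub1 hu))) (pow_pos (hball u (hsub2 hu)) 2)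
  · have hne := (hball u (hsub2 hu)).ne'
    have hz : ∀ a k, partialDeriv k (fun u => X a u 0 * (1 + w u 0)⁻¹) u
        = ((1 + w u 0) * X a u k.succ - X a u 0 * w u k.succ) / (1 + w u 0) ^ 2 := by
      intro a k
      have h1 := ((hX a).differentiableAt Metric.isOpen_ball (hsub1 hu) 0).hasFDerivAt
      have h2 := ((hw.differentiableAt Metric.isOpen_ball (hsub1 hu) 0).hasFDerivAt).const_add 1
      have h3 : HasFDerivAt (fun u => X a u 0 * (1 + w u 0)⁻¹) _ u :=
        h1.mul ((hasDerivAt_inv hne).comp_hasFDerivAt u h2)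
      have e1 := (hX a).eq u (hsub1 hu) k 0
      have e2 := hw.eq u (hsub1 hu) k 0
      simp only [partialDeriv] at e1 e2 ⊢
      rw [h3.fderiv]
      simp only [add_apply, smul_apply, smul_eq_mul, e1, e2]
      fin_cases k <;> simp [hessianSystem, Fin.sum_univ_three] <;> field_simp <;> ring
    have hab := hXX a b u (hsub1 hu)
    have haw := hXw a u (hsub1 hu)
    have hbw := hXw b u (hsub1 hu)
    have hww := hww u (hsub1 hu)
    simp only [hz]
    have hbil : adjugateForm (fun i j => γ i j u)
        (fun k => ((1 + w u 0) * X a u k.succ - X a u 0 * w u k.succ) / (1 + w u 0) ^ 2)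
        (fun k => ((1 + w u 0) * X b u k.succ - X b u 0 * w u k.succ) / (1 + w u 0) ^ 2)
        = ((1 + w u 0) ^ 2 * adjugateForm (fun i j => γ i j u) (fun i => X a u i.succ)
            (fun i => X b u i.succ)
          - (1 + w u 0) * X b u 0 * adjugateForm (fun i j => γ i j u) (fun i => X a u i.succ)
            (fun i => w u i.succ)
          - (1 + w u 0) * X a u 0 * adjugateForm (fun i j => γ i j u) (fun i => X b u i.succ)
            (fun i => w u i.succ)
          + X a u 0 * X b u 0 * adjugateForm (fun i j => γ i j u) (fun i => w u i.succ)
            (fun i => w u i.succ)) / (1 + w u 0) ^ 4 := by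
      simp only [adjugateForm]
      field_simp
      ring
    -- The terms in K cancel because -(1+w)² + 2w(1+w) + (1-w²) = 0, leaving δ_ab·det γ/(1+w)².
    rw [hbil, hab, haw, hbw, hww]
    split_ifs <;> field_simp <;> ring

end Isothermal

/-! ### Inverse function theorem on an open set -/

section LocalDiffeomorphism

/-- The inverse function theorem for a map that is smooth with injective differential on an open
set. -/
theorem exists_openPartialHomeomorph_of_injective_fderiv {E : Type*} [NormedAddCommGroup E]
    [NormedSpace ℝ E] [FiniteDimensional ℝ E] {Z : E → E} {B : Set E} (hB : IsOpen B)
    (hZ : ContDiffOn ℝ ∞ Z B) (hinj : ∀ u ∈ B, Function.Injective (fderiv ℝ Z u)) {u₀ : E}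
    (hu₀ : u₀ ∈ B) : ∃ ψ : OpenPartialHomeomorph E E, u₀ ∈ ψ.source ∧ ψ.source ⊆ B ∧
      (∀ u, ψ u = Z u) ∧ ContDiffOn ℝ ∞ ψ ψ.source ∧ ContDiffOn ℝ ∞ ψ.symm ψ.target := by
  have : CompleteSpace E := FiniteDimensional.complete ℝ E
  have hZat : ∀ u ∈ B, ContDiffAt ℝ ∞ Z u := fun u hu => hZ.contDiffAt (hB.mem_nhds hu)
  have hequiv : ∀ u ∈ B, ∃ f' : E ≃L[ℝ] E, HasFDerivAt Z (f' : E →L[ℝ] E) u := by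
    intro u hu
    refine ⟨(LinearEquiv.ofInjectiveEndo (fderiv ℝ Z u : E →ₗ[ℝ] E)
      (hinj u hu)).toContinuousLinearEquiv, ?_⟩
    convert ((hZat u hu).differentiableAt (by simp)).hasFDerivAt
    ext v
    rfl
  obtain ⟨f', hf'⟩ := hequiv u₀ hu₀
  let ψ₀ := (hZat u₀ hu₀).toOpenPartialHomeomorph Z hf' (by simp)
  have hψ₀ : ∀ u, ψ₀ u = Z u := fun _ => rfl
  have hmem : u₀ ∈ ψ₀.source := (hZat u₀ hu₀).mem_toOpenPartialHomeomorph_source hf' (by simp)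
  -- Restricting to B keeps the differential invertible at every point of the source, so the inverse
  -- is smooth on the whole target and not only at the image of u₀.
  refine ⟨ψ₀.restrOpen B hB, ?_, ?_, fun u => rfl, ?_, ?_⟩
  · simpa using ⟨hmem, hu₀⟩
  · intro u hu
    simp at hu
    exact hu.2
  · intro u hu
    simp at hu
    exact (hZat u hu.2).contDiffWithinAt
  · intro v hv
    have hu := (ψ₀.restrOpen B hB).map_target hv
    simp at hu
    obtain ⟨g', hg'⟩ := hequiv _ hu.2
    exact ((ψ₀.restrOpen B hB).contDiffAt_symm hv hg' (hZat _ hu.2)).contDiffWithinAt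

end LocalDiffeomorphism

/-! ### Coordinate vectors and the metric matrix in a chart -/

namespace Surface

section ChartCalculus

variable {M : Type*} [TopologicalSpace M] [ChartedSpace Plane M]
  {e : OpenPartialHomeomorph M Plane}

/-- The components of tangent vectors at `p` in the chart `e`. -/
noncomputable def coords (e : OpenPartialHomeomorph M Plane) (p : M) :
    TangentSpace (𝓡 2) p →L[ℝ] Plane :=
  mfderiv (𝓡 2) (𝓡 2) e p

theorem mdifferentiable_of_mem_maximalAtlas (he : e ∈ IsManifold.maximalAtlas (𝓡 2) ∞ M) :
    e.MDifferentiable (𝓡 2) (𝓡 2) :=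
  ⟨(contMDiffOn_of_mem_maximalAtlas he).mdifferentiableOn (by simp),
    (contMDiffOn_symm_of_mem_maximalAtlas he).mdifferentiableOn (by simp)⟩

theorem coords_coordVector (he : e ∈ IsManifold.maximalAtlas (𝓡 2) ∞ M) (i : Fin 2) {u : Plane}
    (hu : u ∈ e.target) : coords e (e.symm u) (coordVector e i u)
      = EuclideanSpace.single i (1 : ℝ) := by
  have h := (mdifferentiable_of_mem_maximalAtlas he).comp_symm_deriv hu
  exact congrArg (fun L : Plane →L[ℝ] Plane => L (EuclideanSpace.single i (1 : ℝ))) h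

theorem coords_injective (he : e ∈ IsManifold.maximalAtlas (𝓡 2) ∞ M)
    {p : M} (hp : p ∈ e.source) : Function.Injective (coords e p) := by
  have h := (mdifferentiable_of_mem_maximalAtlas he).symm_comp_deriv hp
  intro v w hvw
  have hv : ∀ v : Plane, (mfderiv (𝓡 2) (𝓡 2) e.symm (e p) : Plane →L[ℝ] Plane)
      ((mfderiv (𝓡 2) (𝓡 2) e p : Plane →L[ℝ] Plane) v) = v := fun v =>
    congrArg (fun L : Plane →L[ℝ] Plane => L v) h
  rw [← hv v, ← hv w]
  exact congrArg _ hvw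

theorem sum_coordVector (he : e ∈ IsManifold.maximalAtlas (𝓡 2) ∞ M) {u : Plane}
    (hu : u ∈ e.target) (v : TangentSpace (𝓡 2) (e.symm u)) :
    v = coords e (e.symm u) v 0 • coordVector e 0 u
      + coords e (e.symm u) v 1 • coordVector e 1 u := by
  apply coords_injective he (e.map_target hu)
  rw [map_add, map_smul, map_smul]
  rw [coords_coordVector he 0 hu, coords_coordVector he 1 hu]
  exact plane_eq_sum _

variable [IsManifold (𝓡 2) ∞ M]

/-- The coordinate field is the image of a constant vector field under the tangent map of the
inverse chart. -/
theorem contMDiffOn_coordVector (he : e ∈ IsManifold.maximalAtlas (𝓡 2) ∞ M) (i : Fin 2) :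
    ContMDiffOn (𝓡 2) (𝓡 2).tangent ∞
      (fun u => (⟨e.symm u, coordVector e i u⟩ : TangentBundle (𝓡 2) M)) e.target := by
  have h1 := contMDiffOn_symm_of_mem_maximalAtlas he
  have h2 := h1.contMDiffOn_tangentMapWithin (m := ∞) (by simp) e.open_target.uniqueMDiffOn
  have h3 : ContMDiffOn (𝓡 2) (𝓡 2).tangent ∞
      (fun u => (⟨u, (EuclideanSpace.single i (1 : ℝ) : Plane)⟩ : TangentBundle (𝓡 2) Plane))
      e.target :=
    contMDiffOn_vectorSpace_iff_contDiffOn.2 contDiffOn_const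
  refine (h2.comp h3 fun u hu => hu).congr fun u hu => ?_
  simp only [Function.comp_apply, tangentMapWithin, coordVector]
  rw [mfderivWithin_of_isOpen e.open_target hu]

theorem contDiffOn_metricMatrix (g : SurfaceMetric M)
    (he : e ∈ IsManifold.maximalAtlas (𝓡 2) ∞ M) (i j : Fin 2) :
    ContDiffOn ℝ ∞ (fun u => metricMatrix g e u i j) e.target := by
  rw [← contMDiffOn_iff_contDiffOn]
  have hs := contMDiffOn_symm_of_mem_maximalAtlas he
  have hi := contMDiffOn_coordVector he i
  have hj := contMDiffOn_coordVector he j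
  intro u hu
  have : ContMDiffWithinAt (𝓡 2) ((𝓡 2).prod 𝓘(ℝ)) ∞
      (fun u => TotalSpace.mk' ℝ (E := Bundle.Trivial M ℝ) (e.symm u)
        (g.inner (e.symm u) (coordVector e i u) (coordVector e j u))) e.target u := by
    apply ContMDiffWithinAt.clm_bundle_apply₂ (F₁ := Plane) (F₂ := Plane)
    · exact ContMDiffAt.comp_contMDiffWithinAt u g.contMDiff.contMDiffAt (hs u hu)
    · exact hi u hu
    · exact hj u hu
  simp only [contMDiffWithinAt_totalSpace] at this
  exact this.2

theorem metricMatrix_symm (g : SurfaceMetric M) (e : OpenPartialHomeomorph M Plane) (u : Plane)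
    (i j : Fin 2) : metricMatrix g e u i j = metricMatrix g e u j i :=
  g.symm _ _ _

theorem metricMatrix_quadratic_pos (g : SurfaceMetric M)
    (he : e ∈ IsManifold.maximalAtlas (𝓡 2) ∞ M) {u : Plane} (hu : u ∈ e.target) {x y : ℝ}
    (hxy : x ≠ 0 ∨ y ≠ 0) : 0 < x * x * metricMatrix g e u 0 0
      + 2 * x * y * metricMatrix g e u 0 1 + y * y * metricMatrix g e u 1 1 := by
  have hne : x • coordVector e 0 u + y • coordVector e 1 u ≠ 0 := by
    intro h0
    have h := congrArg (coords e (e.symm u)) h0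
    rw [map_add, map_smul, map_smul, map_zero, coords_coordVector he 0 hu,
      coords_coordVector he 1 hu] at h
    have hx := congrArg (fun w : Plane => w 0) h
    have hy := congrArg (fun w : Plane => w 1) h
    simp at hx hy
    tauto
  have h := g.pos _ _ hne
  simp only [map_add, map_smul, add_apply, smul_apply, smul_eq_mul] at h
  have hs := metricMatrix_symm g e u 1 0
  simp only [metricMatrix, Matrix.of_apply] at hs ⊢
  rw [hs] at h
  linarith

theorem metricMatrix_zero_zero_pos (g : SurfaceMetric M)
    (he : e ∈ IsManifold.maximalAtlas (𝓡 2) ∞ M) {u : Plane} (hu : u ∈ e.target) :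
    0 < metricMatrix g e u 0 0 := by
  simpa using metricMatrix_quadratic_pos g he hu (x := 1) (y := 0) (by simp)

theorem metricMatrix_det_pos (g : SurfaceMetric M)
    (he : e ∈ IsManifold.maximalAtlas (𝓡 2) ∞ M) {u : Plane} (hu : u ∈ e.target) :
    0 < (metricMatrix g e u).det := by
  have h0 := metricMatrix_zero_zero_pos g he hu
  -- At the vector (-γ₀₁, γ₀₀) the quadratic form equals γ₀₀·det γ.
  have h := metricMatrix_quadratic_pos g he hu (x := -metricMatrix g e u 0 1)
    (y := metricMatrix g e u 0 0) (Or.inr h0.ne')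
  rw [Matrix.det_fin_two, metricMatrix_symm g e u 1 0]
  refine pos_of_mul_pos_right (a := metricMatrix g e u 0 0) ?_ h0.le
  linarith

end ChartCalculus

end Surface

/-! ### Levi-Civita connection and change of chart -/

namespace Surface

section LeviCivita

variable {M : Type*} [TopologicalSpace M] [ChartedSpace Plane M] [IsManifold (𝓡 2) ∞ M]
  {e : OpenPartialHomeomorph M Plane} (g : SurfaceMetric M)

theorem inv_metricMatrix_apply (e : OpenPartialHomeomorph M Plane) (u : Plane) (i j : Fin 2) :
    (metricMatrix g e u)⁻¹ i j
      = ((metricMatrix g e u).det)⁻¹ * (metricMatrix g e u).adjugate i j := by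
  rw [Matrix.inv_def, Ring.inverse_eq_inv']
  rfl

theorem contDiffOn_inv_metricMatrix (he : e ∈ IsManifold.maximalAtlas (𝓡 2) ∞ M) (i j : Fin 2) :
    ContDiffOn ℝ ∞ (fun u => (metricMatrix g e u)⁻¹ i j) e.target := by
  have hm := contDiffOn_metricMatrix g he
  have hdet : ContDiffOn ℝ ∞ (fun u => (metricMatrix g e u).det) e.target := by
    simp only [Matrix.det_fin_two]
    exact ((hm 0 0).mul (hm 1 1)).sub ((hm 0 1).mul (hm 1 0))
  have hadj : ContDiffOn ℝ ∞ (fun u => (metricMatrix g e u).adjugate i j) e.target := by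
    simp only [Matrix.adjugate_fin_two]
    fin_cases i <;> fin_cases j
    · exact hm 1 1
    · exact (hm 0 1).neg
    · exact (hm 1 0).neg
    · exact hm 0 0
  exact ((hdet.inv fun u hu => (metricMatrix_det_pos g he hu).ne').mul hadj).congr
    fun u _ => inv_metricMatrix_apply g e u i j

theorem contDiffOn_christoffel (he : e ∈ IsManifold.maximalAtlas (𝓡 2) ∞ M) (k i j : Fin 2) :
    ContDiffOn ℝ ∞ (christoffel g e k i j) e.target := by
  have hm := contDiffOn_metricMatrix g he
  have hp : ∀ i j k, ContDiffOn ℝ ∞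
      (fun u => partialDeriv k (fun v => metricMatrix g e v i j) u) e.target :=
    fun i j k => (hm i j).partialDeriv k e.open_target
  exact contDiffOn_const.mul (ContDiffOn.sum fun l _ =>
    (contDiffOn_inv_metricMatrix g he k l).mul (((hp j l i).add (hp i l j)).sub (hp i j l)))

theorem christoffel_symm (k i j : Fin 2) (u : Plane) :
    christoffel g e k i j u = christoffel g e k j i u := by
  simp only [christoffel]
  congr 1
  refine Finset.sum_congr rfl fun l _ => ?_
  rw [show (fun v => metricMatrix g e v i j) = fun v => metricMatrix g e v j i from
    funext fun v => metricMatrix_symm g e v i j]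
  ring

/-- Lowering the upper index cancels the inverse matrix; this is Koszul's formula, from which
compatibility with the metric follows. -/
theorem sum_metricMatrix_mul_christoffel (he : e ∈ IsManifold.maximalAtlas (𝓡 2) ∞ M)
    {u : Plane} (hu : u ∈ e.target) (m i j : Fin 2) :
    ∑ k, metricMatrix g e u m k * christoffel g e k i j u
      = (1 / 2) * (partialDeriv i (fun v => metricMatrix g e v j m) u
        + partialDeriv j (fun v => metricMatrix g e v i m) u
        - partialDeriv m (fun v => metricMatrix g e v i j) u) := by
  have h := Matrix.mul_nonsing_inv (metricMatrix g e u)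
    (metricMatrix_det_pos g he hu).ne'.isUnit
  have hm : ∀ l, metricMatrix g e u m 0 * (metricMatrix g e u)⁻¹ 0 l
      + metricMatrix g e u m 1 * (metricMatrix g e u)⁻¹ 1 l = (1 : Matrix _ _ ℝ) m l := by
    intro l
    rw [← h, Matrix.mul_apply, Fin.sum_univ_two]
  have h0 := hm 0
  have h1 := hm 1
  simp only [christoffel, Fin.sum_univ_two]
  set P : Fin 2 → ℝ := fun l => partialDeriv i (fun v => metricMatrix g e v j l) u
        + partialDeriv j (fun v => metricMatrix g e v i l) u
        - partialDeriv l (fun v => metricMatrix g e v i j) u with hP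
  change _ = 1 / 2 * P m
  change metricMatrix g e u m 0 * (1 / 2 * ((metricMatrix g e u)⁻¹ 0 0 * P 0
    + (metricMatrix g e u)⁻¹ 0 1 * P 1)) + metricMatrix g e u m 1 *
    (1 / 2 * ((metricMatrix g e u)⁻¹ 1 0 * P 0 + (metricMatrix g e u)⁻¹ 1 1 * P 1)) = _
  have hPm : ∀ m, P m = (1 : Matrix (Fin 2) (Fin 2) ℝ) m 0 * P 0
      + (1 : Matrix (Fin 2) (Fin 2) ℝ) m 1 * P 1 :=
    Fin.forall_fin_two.2 ⟨by simp, by simp⟩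
  rw [hPm m]
  linear_combination (1 / 2 * P 0) * h0 + (1 / 2 * P 1) * h1

/-- The Christoffel symbols of a metric in a chart form a torsion-free compatible connection. -/
theorem isLocalConnection (he : e ∈ IsManifold.maximalAtlas (𝓡 2) ∞ M) :
    IsLocalConnection e.target (fun i j u => metricMatrix g e u i j) (christoffel g e) where
  isOpen := e.open_target
  smooth := contDiffOn_metricMatrix g he
  smooth_connection := contDiffOn_christoffel g he
  symm u _ := metricMatrix_symm g e u 1 0
  pos u hu := metricMatrix_zero_zero_pos g he hu
  det_pos u hu := by
    have h := metricMatrix_det_pos g he hu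
    rwa [Matrix.det_fin_two, metricMatrix_symm g e u 1 0] at h
  torsion u _ k := christoffel_symm g k 1 0 u
  compat u hu m i j := by
    -- In the sum of the two Koszul formulas every derivative cancels except ∂ₘγᵢⱼ.
    have h1 := sum_metricMatrix_mul_christoffel g he hu j m i
    have h2 := sum_metricMatrix_mul_christoffel g he hu i m j
    rw [Finset.sum_add_distrib, h2]
    simp only [metricMatrix_symm g e _ _ j] at h1 h2 ⊢
    rw [h1]
    simp only [metricMatrix_symm g e _ m i]
    ring

end LeviCivita

section ChangeOfChart

variable {M : Type*} [TopologicalSpace M] [ChartedSpace Plane M]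
  {e : OpenPartialHomeomorph M Plane} {ψ : OpenPartialHomeomorph Plane Plane}

theorem trans_mem_maximalAtlas (he : e ∈ IsManifold.maximalAtlas (𝓡 2) ∞ M)
    (hψ : ContDiffOn ℝ ∞ ψ ψ.source) (hψ' : ContDiffOn ℝ ∞ ψ.symm ψ.target) :
    e.trans ψ ∈ IsManifold.maximalAtlas (𝓡 2) ∞ M := by
  have hG : ψ ∈ contDiffGroupoid ∞ (𝓡 2) := by
    rw [contDiffGroupoid, mem_groupoid_of_pregroupoid]
    simpa [contDiffPregroupoid] using ⟨hψ, hψ'⟩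
  have hG' : ψ.symm ∈ contDiffGroupoid ∞ (𝓡 2) := (contDiffGroupoid ∞ (𝓡 2)).symm hG
  rw [IsManifold.maximalAtlas, mem_maximalAtlas_iff] at he ⊢
  intro e' he'
  rw [OpenPartialHomeomorph.trans_symm_eq_symm_trans_symm, OpenPartialHomeomorph.trans_assoc,
    ← OpenPartialHomeomorph.trans_assoc e'.symm]
  exact ⟨(contDiffGroupoid ∞ (𝓡 2)).trans hG' (he e' he').1,
    (contDiffGroupoid ∞ (𝓡 2)).trans (he e' he').2 hG⟩

theorem coordVector_trans (he : e ∈ IsManifold.maximalAtlas (𝓡 2) ∞ M)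
    (hψ' : ContDiffOn ℝ ∞ ψ.symm ψ.target) {v : Plane} (hv : v ∈ (e.trans ψ).target)
    (i : Fin 2) : coordVector (e.trans ψ) i v
      = (fderiv ℝ ψ.symm v (EuclideanSpace.single i 1) 0 • coordVector e 0 (ψ.symm v)
      + fderiv ℝ ψ.symm v (EuclideanSpace.single i 1) 1 • coordVector e 1 (ψ.symm v) :
        TangentSpace (𝓡 2) (e.symm (ψ.symm v))) := by
  rw [OpenPartialHomeomorph.trans_target] at hv
  have h1 : MDifferentiableAt (𝓡 2) (𝓡 2) e.symm (ψ.symm v) :=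
    (mdifferentiable_of_mem_maximalAtlas he).mdifferentiableAt_symm hv.2
  have h2 : MDifferentiableAt (𝓡 2) (𝓡 2) ψ.symm v :=
    ((hψ'.contDiffAt (ψ.open_target.mem_nhds hv.1)).differentiableAt (by simp)).mdifferentiableAt
  have h3 := mfderiv_comp v h1 h2
  let L : Plane →L[ℝ] TangentSpace (𝓡 2) (e.symm (ψ.symm v)) :=
    mfderiv (𝓡 2) (𝓡 2) e.symm (ψ.symm v)
  have h4 : coordVector (e.trans ψ) i v = L (fderiv ℝ ψ.symm v (EuclideanSpace.single i 1)) := by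
    rw [← mfderiv_eq_fderiv]
    exact congrArg (fun L : Plane →L[ℝ] Plane => L (EuclideanSpace.single i (1 : ℝ))) h3
  have h5 : ∀ w : Plane, L w = w 0 • L (EuclideanSpace.single 0 1)
      + w 1 • L (EuclideanSpace.single 1 1) := by
    intro w
    conv_lhs => rw [plane_eq_sum w]
    rw [map_add, map_smul, map_smul]
  rw [h4, h5]
  rfl

variable [IsManifold (𝓡 2) ∞ M]

theorem metricMatrix_trans (g : SurfaceMetric M) (he : e ∈ IsManifold.maximalAtlas (𝓡 2) ∞ M)
    (hψ' : ContDiffOn ℝ ∞ ψ.symm ψ.target) {v : Plane} (hv : v ∈ (e.trans ψ).target)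
    {J : Matrix (Fin 2) (Fin 2) ℝ}
    (hJ : ∀ k i, J k i = fderiv ℝ ψ.symm v (EuclideanSpace.single i 1) k) :
    metricMatrix g (e.trans ψ) v = J.transpose * metricMatrix g e (ψ.symm v) * J := by
  ext i j
  have h : metricMatrix g (e.trans ψ) v i j
      = g.inner (e.symm (ψ.symm v)) (coordVector (e.trans ψ) i v)
        (coordVector (e.trans ψ) j v) := rfl
  rw [h, coordVector_trans he hψ' hv, coordVector_trans he hψ' hv]
  simp only [map_add, map_smul, add_apply, smul_apply, smul_eq_mul, ← hJ, Matrix.mul_apply,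
    Fin.sum_univ_two, Matrix.transpose_apply, metricMatrix, Matrix.of_apply]
  ring

end ChangeOfChart

end Surface

/-! ### Isothermal charts and the gradient in them -/

namespace Surface

/-- The chart `e` is isothermal for the metric `g`, with conformal factor `lam`. -/
def IsIsothermal {M : Type*} [TopologicalSpace M] [ChartedSpace Plane M] [IsManifold (𝓡 2) ∞ M]
    (g : SurfaceMetric M) (e : OpenPartialHomeomorph M Plane) (lam : Plane → ℝ) : Prop :=
  ∀ u ∈ e.target, 0 < lam u ∧ metricMatrix g e u = lam u • (1 : Matrix (Fin 2) (Fin 2) ℝ)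

/-- Meant for G the metric, A its adjugate, D its determinant, P the Jacobian of the isothermal
functions and J that of the inverse map. Replacing μ by P A Pᵗ on the right of Jᵗ G J lets J P and
then G A collapse. -/
theorem smul_transpose_mul_mul_eq {n : Type*} [Fintype n] [DecidableEq n] {G A P J : Matrix n n ℝ}
    {D μ : ℝ} (hGA : G * A = D • 1) (hPJ : P * J = 1) (h : P * A * P.transpose = μ • 1) :
    μ • (J.transpose * G * J) = D • (1 : Matrix n n ℝ) := by
  have hJP : J * P = 1 := mul_eq_one_comm.1 hPJ
  have hJPt : J.transpose * P.transpose = 1 := by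
    rw [← Matrix.transpose_mul, hPJ, Matrix.transpose_one]
  calc μ • (J.transpose * G * J) = J.transpose * G * J * (μ • 1) := by
        rw [Matrix.mul_smul, Matrix.mul_one]
    _ = J.transpose * G * (J * P) * A * P.transpose := by
        rw [← h]
        simp only [Matrix.mul_assoc]
    _ = J.transpose * (G * A) * P.transpose := by
        rw [hJP, Matrix.mul_one]
        simp only [Matrix.mul_assoc]
    _ = D • 1 := by
        rw [hGA, Matrix.mul_smul, Matrix.mul_one, Matrix.smul_mul, hJPt]

section Existence

variable {M : Type*} [TopologicalSpace M] [ChartedSpace Plane M] [IsManifold (𝓡 2) ∞ M]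

/-- A metric of constant curvature has isothermal charts around every point. -/
theorem exists_isIsothermal {g : SurfaceMetric M} (hg : HasConstantCurvature g) (p : M) :
    ∃ e ∈ IsManifold.maximalAtlas (𝓡 2) ∞ M, p ∈ e.source ∧ e p = 0 ∧
      ∃ lam : Plane → ℝ, IsIsothermal g e lam := by
  obtain ⟨K, hK⟩ := hg
  set e := chartAt Plane p with he_def
  have he : e ∈ IsManifold.maximalAtlas (𝓡 2) ∞ M := IsManifold.chart_mem_maximalAtlas p
  have hp : p ∈ e.source := mem_chart_source Plane p
  have hdet : ∀ u, (metricMatrix g e u).det = metricMatrix g e u 0 0 * metricMatrix g e u 1 1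
      - metricMatrix g e u 0 1 * metricMatrix g e u 0 1 := fun u => by
    rw [Matrix.det_fin_two, metricMatrix_symm g e u 1 0]
  obtain ⟨δ, hδ, hsub, z, hz0, hzs, μ, hμ⟩ := (isLocalConnection g he).exists_isothermal (K := K)
    (fun u hu => by
      have h := hK e he u hu
      rw [gaussCurvature, div_eq_iff (metricMatrix_det_pos g he hu).ne', hdet] at h
      exact h) (e.map_source hp)
  let P : Plane → Matrix (Fin 2) (Fin 2) ℝ := fun u => Matrix.of fun a k => partialDeriv k (z a) u
  have hP : ∀ u ∈ Metric.ball (e p) δ,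
      P u * (metricMatrix g e u).adjugate * (P u).transpose = μ u • 1 := by
    intro u hu
    ext a b
    have h := (hμ u hu).2 a b
    rw [Matrix.adjugate_fin_two, metricMatrix_symm g e u 1 0]
    simp [Matrix.mul_apply, Fin.sum_univ_two, P, Matrix.one_apply]
    rw [← h, adjugateForm]
    ring
  let Z : Plane → Plane := fun u => WithLp.toLp 2 fun a => z a u
  have hZs : ContDiffOn ℝ ∞ Z (Metric.ball (e p) δ) := by
    rw [contDiffOn_piLp]
    exact hzs
  have hZd : ∀ u ∈ Metric.ball (e p) δ, ∀ (v : Plane) (a : Fin 2),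
      fderiv ℝ Z u v a = ∑ k, P u a k * v k := by
    intro u hu v a
    have h1 : HasFDerivAt (fun u => Z u a) ((EuclideanSpace.proj a : Plane →L[ℝ] ℝ).comp
        (fderiv ℝ Z u)) u :=
      (EuclideanSpace.proj a : Plane →L[ℝ] ℝ).hasFDerivAt.comp u
        ((hZs.contDiffAt (Metric.isOpen_ball.mem_nhds hu)).differentiableAt (by simp)).hasFDerivAt
    have h2 : fderiv ℝ (z a) u v = fderiv ℝ Z u v a :=
      congrArg (fun L : Plane →L[ℝ] ℝ => L v) h1.fderiv
    rw [← h2, fderiv_eq_partialDeriv, Fin.sum_univ_two]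
    simp only [P, Matrix.of_apply]
    ring
  have hinj : ∀ u ∈ Metric.ball (e p) δ, Function.Injective (fderiv ℝ Z u) := by
    intro u hu
    rw [injective_iff_map_eq_zero]
    intro v hv
    have h1 : (P u).mulVec v.ofLp = 0 := by
      ext a
      have h2 := hZd u hu v a
      rw [hv] at h2
      exact h2.symm
    -- The isothermal relation exhibits a right inverse of the Jacobian, which for square matrices
    -- is also a left inverse.
    have h3 : (P u) * ((μ u)⁻¹ • ((metricMatrix g e u).adjugate * (P u).transpose)) = 1 := by
      rw [Matrix.mul_smul, ← Matrix.mul_assoc, hP u hu, smul_smul,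
        inv_mul_cancel₀ (hμ u hu).1.ne', one_smul]
    have h4 := mul_eq_one_comm.1 h3
    have h5 : v.ofLp = 0 := by
      rw [← Matrix.one_mulVec v.ofLp, ← h4, ← Matrix.mulVec_mulVec, h1, Matrix.mulVec_zero]
    ext a
    exact congrFun h5 a
  obtain ⟨ψ, hψ0, hψB, hψZ, hψs, hψs'⟩ := exists_openPartialHomeomorph_of_injective_fderiv
    Metric.isOpen_ball hZs hinj (Metric.mem_ball_self hδ)
  -- The adjugate is det times the inverse, so the new differentials have squared length μ/det; the
  -- conformal factor is its reciprocal.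
  refine ⟨e.trans ψ, trans_mem_maximalAtlas he hψs hψs', ?_, ?_,
    fun v => (metricMatrix g e (ψ.symm v)).det / μ (ψ.symm v), ?_⟩
  · rw [OpenPartialHomeomorph.trans_source]
    exact ⟨hp, hψ0⟩
  · rw [OpenPartialHomeomorph.coe_trans, Function.comp_apply, hψZ]
    ext a
    exact hz0 a
  · intro v hv
    have hv' := hv
    rw [OpenPartialHomeomorph.trans_target] at hv'
    have hu := hψB (ψ.map_target hv'.1)
    have hμpos := (hμ _ hu).1
    refine ⟨div_pos (metricMatrix_det_pos g he hv'.2) hμpos, ?_⟩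
    let J : Matrix (Fin 2) (Fin 2) ℝ :=
      Matrix.of fun k i => fderiv ℝ ψ.symm v (EuclideanSpace.single i 1) k
    have hPJ : P (ψ.symm v) * J = 1 := by
      have h1 : HasFDerivAt (fun w => Z (ψ.symm w))
          ((fderiv ℝ Z (ψ.symm v)).comp (fderiv ℝ ψ.symm v)) v :=
        ((hZs.contDiffAt (Metric.isOpen_ball.mem_nhds hu)).differentiableAt
          (by simp)).hasFDerivAt.comp v
          ((hψs'.contDiffAt (ψ.open_target.mem_nhds hv'.1)).differentiableAt (by simp)).hasFDerivAt
      have h2 : HasFDerivAt (fun w => Z (ψ.symm w)) (ContinuousLinearMap.id ℝ Plane) v := by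
        refine (hasFDerivAt_id v).congr_of_eventuallyEq ?_
        filter_upwards [ψ.open_target.mem_nhds hv'.1] with w hw
        rw [← hψZ, ψ.right_inv hw]
        rfl
      ext a i
      have h3 := congrArg (fun L : Plane →L[ℝ] Plane => L (EuclideanSpace.single i 1) a)
        (h1.unique h2)
      simp only [ContinuousLinearMap.comp_apply, hZd _ hu] at h3
      rw [Matrix.mul_apply]
      simp only [J, Matrix.of_apply]
      rw [h3]
      simp [Matrix.one_apply]
    rw [metricMatrix_trans g he hψs' hv (J := J) fun k i => rfl]
    have h4 := smul_transpose_mul_mul_eq (Matrix.mul_adjugate (metricMatrix g e (ψ.symm v)))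
      hPJ (hP _ hu)
    beta_reduce
    rw [div_eq_inv_mul, mul_smul, ← h4, smul_smul, inv_mul_cancel₀ hμpos.ne', one_smul]

end Existence

section Gradient

variable {M : Type*} [TopologicalSpace M] [ChartedSpace Plane M] [IsManifold (𝓡 2) ∞ M]

/-- The matrix of the metric is λ times the identity, so raising the index of dH only divides by λ.
-/
theorem coords_gradient {g : SurfaceMetric M} {e : OpenPartialHomeomorph M Plane}
    (he : e ∈ IsManifold.maximalAtlas (𝓡 2) ∞ M) {lam : Plane → ℝ} (h : IsIsothermal g e lam)
    {u : Plane} (hu : u ∈ e.target) {H : M → ℝ}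
    (hH : MDifferentiableAt (𝓡 2) 𝓘(ℝ, ℝ) H (e.symm u)) (i : Fin 2) :
    coords e (e.symm u) (gradient g H (e.symm u)) i
      = (lam u)⁻¹ * partialDeriv i (fun v => H (e.symm v)) u := by
  obtain ⟨hpos, hmat⟩ := h u hu
  have h1 : partialDeriv i (fun v => H (e.symm v)) u
      = mfderiv (𝓡 2) 𝓘(ℝ, ℝ) H (e.symm u) (coordVector e i u) := by
    have h2 := mfderiv_comp u hH
      ((mdifferentiable_of_mem_maximalAtlas he).mdifferentiableAt_symm hu)
    rw [partialDeriv, ← mfderiv_eq_fderiv]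
    exact congrArg (fun L : Plane →L[ℝ] ℝ => L (EuclideanSpace.single i (1 : ℝ))) h2
  have h3 : ∀ k l, g.inner (e.symm u) (coordVector e k u) (coordVector e l u)
      = lam u * (1 : Matrix (Fin 2) (Fin 2) ℝ) k l := fun k l =>
    congrArg (fun A : Matrix (Fin 2) (Fin 2) ℝ => A k l) hmat
  rw [h1, ← inner_gradient g H (e.symm u) (coordVector e i u)]
  conv_rhs => rw [sum_coordVector he hu (gradient g H (e.symm u))]
  simp only [map_add, map_smul, add_apply, smul_apply, smul_eq_mul, h3]
  obtain rfl | rfl : i = 0 ∨ i = 1 := by fin_cases i <;> simp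
  · simp only [Matrix.one_apply_eq, ne_eq, one_ne_zero, not_false_eq_true, Matrix.one_apply_ne]
    field_simp
    ring
  · simp only [Matrix.one_apply_eq, ne_eq, zero_ne_one, not_false_eq_true, Matrix.one_apply_ne]
    field_simp
    ring

end Gradient

end Surface

/-! ### Integration by parts against test functions -/

section FDerivApply

variable {E V : Type*} [NormedAddCommGroup E] [NormedSpace ℝ E]
  [NormedAddCommGroup V] [NormedSpace ℝ V]

theorem ContDiff.fderiv_apply_const {θ : E → V} (h : ContDiff ℝ ∞ θ) (v : E) :
    ContDiff ℝ ∞ (fun z => fderiv ℝ θ z v) :=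
  (h.fderiv_right (m := ∞) (by simp)).clm_apply contDiff_const

theorem ContDiffOn.fderiv_apply_const {θ : E → V} {U : Set E} (hU : IsOpen U)
    (h : ContDiffOn ℝ ∞ θ U) (v : E) : ContDiffOn ℝ ∞ (fun z => fderiv ℝ θ z v) U :=
  (h.fderiv_of_isOpen (m := ∞) hU (by simp)).clm_apply contDiffOn_const

end FDerivApply

section IntegrationByParts

variable {E V : Type*} [NormedAddCommGroup E] [NormedSpace ℝ E] [FiniteDimensional ℝ E]
  [MeasurableSpace E] [BorelSpace E] [NormedAddCommGroup V] [NormedSpace ℝ V]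

theorem MeasureTheory.LocallyIntegrableOn.integrable_smul_of_tsupport_subset {μ : Measure E}
    {f : E → ℝ} {U : Set E} (hf : LocallyIntegrableOn f U μ) {θ : E → V} (hθ : Continuous θ)
    (hc : HasCompactSupport θ) (hs : tsupport θ ⊆ U) : Integrable (fun z => f z • θ z) μ := by
  have h := (hf.integrableOn_compact_subset hs hc).smul_continuousOn hθ.continuousOn hc
  refine (integrableOn_iff_integrable_of_support_subset ?_).1 h
  intro z hz
  refine subset_tsupport _ fun h0 => hz ?_
  simp only [h0, smul_zero]

/-- Integration by parts against a test function supported where the other factor is smooth. -/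
theorem integral_smul_fderiv_of_tsupport_subset {μ : Measure E} [μ.IsAddHaarMeasure] {U : Set E}
    (hU : IsOpen U) {f : E → ℝ} (hf : ContDiffOn ℝ ∞ f U) {θ : E → V} (hθ : ContDiff ℝ ∞ θ)
    (hc : HasCompactSupport θ) (hs : tsupport θ ⊆ U) (v : E) :
    ∫ z, f z • fderiv ℝ θ z v ∂μ = - ∫ z, fderiv ℝ f z v • θ z ∂μ := by
  have hfl := hf.continuousOn.locallyIntegrableOn (μ := μ) hU.measurableSet
  have hfl' := (hf.fderiv_apply_const hU v).continuousOn.locallyIntegrableOn (μ := μ)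
    hU.measurableSet
  exact integral_smul_fderiv_eq_neg_fderiv_smul_of_integrable
    (hfl'.integrable_smul_of_tsupport_subset hθ.continuous hc hs)
    (hfl.integrable_smul_of_tsupport_subset (hθ.fderiv_apply_const v).continuous
      (hc.fderiv_apply ℝ v) ((tsupport_fderiv_apply_subset (f := θ) ℝ v).trans hs))
    (hfl.integrable_smul_of_tsupport_subset hθ.continuous hc hs)
    (fun z hz => (hf.contDiffAt (hU.mem_nhds (hs hz))).differentiableAt (by simp))
    fun z _ => hθ.differentiable (by simp) z

end IntegrationByParts

/-! ### Green's functions of the flat Laplacian on a disc -/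

section PlaneGreen

open Complex Metric

/-- `f` is a Green's function of the flat Laplacian on the disc of radius `R`, with pole `0`. -/
structure IsDiscGreen (f : ℂ → ℝ) (R : ℝ) : Prop where
  smooth : ContDiffOn ℝ ∞ f (ball 0 R \ {0})
  locallyIntegrable : LocallyIntegrableOn f (ball 0 R)
  laplacian_eq : ∀ φ : ℂ → ℝ, ContDiff ℝ ∞ φ → HasCompactSupport φ → tsupport φ ⊆ ball 0 R →
    ∫ z, f z * (fderiv ℝ (fun w => fderiv ℝ φ w 1) z 1 + fderiv ℝ (fun w => fderiv ℝ φ w I) z I)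
      = -φ 0

/-- The Wirtinger-type derivative `∂f/∂x - i ∂f/∂y`. -/
noncomputable def complexGradient (f : ℂ → ℝ) (z : ℂ) : ℂ :=
  fderiv ℝ f z 1 - I * fderiv ℝ f z I

theorem isOpen_puncturedBall (R : ℝ) : IsOpen (ball (0 : ℂ) R \ {0}) :=
  isOpen_ball.sdiff isClosed_singleton

namespace IsDiscGreen

variable {f : ℂ → ℝ} {R : ℝ}

/-- Off the pole f is smooth, so two integrations by parts against test functions supported there
reduce the claim to the fundamental lemma of the calculus of variations. -/
theorem laplacian_eq_zero (h : IsDiscGreen f R) {z : ℂ} (hz : z ∈ ball (0 : ℂ) R \ {0}) :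
    fderiv ℝ (fun w => fderiv ℝ f w 1) z 1 + fderiv ℝ (fun w => fderiv ℝ f w I) z I = 0 := by
  have hU := isOpen_puncturedBall R
  have hs : ∀ v, ContDiffOn ℝ ∞ (fun w => fderiv ℝ (fun w => fderiv ℝ f w v) w v)
      (ball 0 R \ {0}) := fun v => (h.smooth.fderiv_apply_const hU v).fderiv_apply_const hU v
  have hL := ((hs 1).add (hs I)).continuousOn
  have hae := hU.ae_eq_zero_of_integral_contDiff_smul_eq_zero (μ := volume)
    (hL.locallyIntegrableOn hU.measurableSet) (by
      intro φ hφ hc hsupp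
      have h1 := h.laplacian_eq φ hφ hc (hsupp.trans sdiff_subset)
      have h2 : φ 0 = 0 := by
        by_contra h0
        exact (hsupp (subset_tsupport φ h0)).2 rfl
      have hA : ∀ v : ℂ, ∫ z, f z * fderiv ℝ (fun w => fderiv ℝ φ w v) z v
          = ∫ z, fderiv ℝ (fun w => fderiv ℝ f w v) z v * φ z := by
        intro v
        have h3 := integral_smul_fderiv_of_tsupport_subset (μ := volume) hU h.smooth
          (hφ.fderiv_apply_const v) (hc.fderiv_apply ℝ v)
          ((tsupport_fderiv_apply_subset (f := φ) ℝ v).trans hsupp) v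
        have h4 := integral_smul_fderiv_of_tsupport_subset (μ := volume) hU
          (h.smooth.fderiv_apply_const hU v) hφ hc hsupp v
        simp only [smul_eq_mul] at h3 h4
        rw [h3, h4, neg_neg]
      have hi : ∀ v : ℂ, Integrable fun z => f z * fderiv ℝ (fun w => fderiv ℝ φ w v) z v :=
        fun v => h.locallyIntegrable.integrable_smul_of_tsupport_subset
          ((hφ.fderiv_apply_const v).fderiv_apply_const v).continuous
          ((hc.fderiv_apply ℝ v).fderiv_apply ℝ v)
          (((tsupport_fderiv_apply_subset ℝ v).trans
            (tsupport_fderiv_apply_subset (f := φ) ℝ v)).trans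
            (hsupp.trans sdiff_subset))
      have hi' : ∀ v : ℂ, Integrable fun z => fderiv ℝ (fun w => fderiv ℝ f w v) z v * φ z :=
        fun v => ((hs v).continuousOn.locallyIntegrableOn
          hU.measurableSet).integrable_smul_of_tsupport_subset hφ.continuous hc hsupp
      simp only [mul_add] at h1
      rw [integral_add (hi 1) (hi I), hA, hA, ← integral_add (hi' 1) (hi' I), h2, neg_zero] at h1
      rw [← h1]
      refine integral_congr_ae (Filter.Eventually.of_forall fun z => ?_)
      simp only [smul_eq_mul]
      ring)
  -- The Laplacian is continuous: if nonzero at z, it is nonzero on an open set, which cannot be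
  -- null.
  by_contra hne
  have hopen : IsOpen ((ball 0 R \ {0}) ∩ (fun z => fderiv ℝ (fun w => fderiv ℝ f w 1) z 1
      + fderiv ℝ (fun w => fderiv ℝ f w I) z I) ⁻¹' {0}ᶜ) :=
    hL.isOpen_inter_preimage hU isOpen_compl_singleton
  have hnull : volume ((ball 0 R \ {0}) ∩ (fun z => fderiv ℝ (fun w => fderiv ℝ f w 1) z 1
      + fderiv ℝ (fun w => fderiv ℝ f w I) z I) ⁻¹' {0}ᶜ) = 0 := by
    refine measure_mono_null ?_ hae
    intro x hx hx'
    exact hx.2 (hx' hx.1)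
  exact (hopen.measure_pos volume ⟨z, hz, hne⟩).ne' hnull

theorem differentiableOn_complexGradient (h : IsDiscGreen f R) :
    DifferentiableOn ℂ (complexGradient f) (ball 0 R \ {0}) := by
  have hU := isOpen_puncturedBall R
  intro z hz
  refine (HarmonicAt.differentiableAt_complex_partial (f := f)
    ⟨(h.smooth.contDiffAt (hU.mem_nhds hz)).of_le (WithTop.coe_le_coe.2 le_top),
      ?_⟩).differentiableWithinAt
  filter_upwards [hU.mem_nhds hz] with x hx
  have hd : DifferentiableAt ℝ (fderiv ℝ f) x :=
    ((h.smooth.contDiffAt (hU.mem_nhds hx)).fderiv_right (m := ∞) (by simp)).differentiableAt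
      (by simp)
  have h2 : ∀ v : ℂ, fderiv ℝ (fun w => fderiv ℝ f w v) x v = fderiv ℝ (fderiv ℝ f) x v v := by
    intro v
    rw [fderiv_clm_apply hd (differentiableAt_const v)]
    simp
  rw [InnerProductSpace.laplacian_eq_iteratedFDeriv_complexPlane]
  simp only [iteratedFDeriv_two_apply]
  have h3 := h.laplacian_eq_zero hx
  rw [h2, h2] at h3
  simpa using h3

/-- Complex test functions are needed in order to use holomorphic ones; the real equation is applied
to the real and imaginary parts. -/
theorem integral_smul_laplacian (h : IsDiscGreen f R) {φ : ℂ → ℂ} (hφ : ContDiff ℝ ∞ φ)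
    (hc : HasCompactSupport φ) (hs : tsupport φ ⊆ ball 0 R) :
    ∫ z, f z • (fderiv ℝ (fun w => fderiv ℝ φ w 1) z 1
      + fderiv ℝ (fun w => fderiv ℝ φ w I) z I) = -φ 0 := by
  have hL : ∀ (L : ℂ →L[ℝ] ℝ), L (∫ z, f z • (fderiv ℝ (fun w => fderiv ℝ φ w 1) z 1
      + fderiv ℝ (fun w => fderiv ℝ φ w I) z I)) = L (-φ 0) := by
    intro L
    have hcomp : ∀ (θ : ℂ → ℂ), ContDiff ℝ ∞ θ → ∀ z v,
        fderiv ℝ (fun w => L (θ w)) z v = L (fderiv ℝ θ z v) := by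
      intro θ hθ z v
      have h1 := L.hasFDerivAt.comp z (hθ.differentiable (by simp) z).hasFDerivAt
      exact congrArg (fun A : ℂ →L[ℝ] ℝ => A v) h1.fderiv
    have hsub : tsupport (fun w => L (φ w)) ⊆ tsupport φ :=
      closure_mono fun w hw h0 => hw (by simp only [h0, map_zero])
    have h1 := h.laplacian_eq (fun w => L (φ w)) (L.contDiff.comp hφ)
      (hc.comp_left (map_zero L)) (hsub.trans hs)
    rw [map_neg, ← h1, ← L.integral_comp_comm]
    · refine integral_congr_ae (Filter.Eventually.of_forall fun z => ?_)
      simp only [hcomp φ hφ, hcomp _ (hφ.fderiv_apply_const _), map_smul, map_add, smul_eq_mul]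
    · simp only [smul_add]
      have hi : ∀ v : ℂ, Integrable fun z => f z • fderiv ℝ (fun w => fderiv ℝ φ w v) z v :=
        fun v => h.locallyIntegrable.integrable_smul_of_tsupport_subset
          ((hφ.fderiv_apply_const v).fderiv_apply_const v).continuous
          ((hc.fderiv_apply ℝ v).fderiv_apply ℝ v)
          (((tsupport_fderiv_apply_subset ℝ v).trans
            (tsupport_fderiv_apply_subset (f := φ) ℝ v)).trans hs)
      exact (hi 1).add (hi I)
  exact Complex.ext (hL reCLM) (hL imCLM)

/-- If `∂φ/∂x + i ∂φ/∂y` is supported off the pole, the equation can be integrated by parts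
once. -/
theorem integral_complexGradient_mul (h : IsDiscGreen f R) {φ : ℂ → ℂ} (hφ : ContDiff ℝ ∞ φ)
    (hc : HasCompactSupport φ) (hs : tsupport φ ⊆ ball 0 R)
    (h0 : (0 : ℂ) ∉ tsupport fun z => fderiv ℝ φ z 1 + I * fderiv ℝ φ z I) :
    ∫ z, complexGradient f z * (fderiv ℝ φ z 1 + I * fderiv ℝ φ z I) = φ 0 := by
  have hU := isOpen_puncturedBall R
  set θ : ℂ → ℂ := fun z => fderiv ℝ φ z 1 + I * fderiv ℝ φ z I with hθ_def
  have hθ : ContDiff ℝ ∞ θ :=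
    (hφ.fderiv_apply_const 1).add (contDiff_const.mul (hφ.fderiv_apply_const I))
  have hθc : HasCompactSupport θ := (hc.fderiv_apply ℝ 1).add (hc.fderiv_apply ℝ I).mul_left
  have hθs : tsupport θ ⊆ ball 0 R \ {0} := by
    refine fun z hz => ⟨hs ?_, fun hz0 => h0 (by rwa [mem_singleton_iff.1 hz0] at hz)⟩
    have h1 : tsupport θ ⊆ tsupport (fun z => fderiv ℝ φ z) :=
      closure_mono fun w hw h0 => hw (by simp only [θ, h0]; simp)
    exact tsupport_fderiv_subset ℝ (h1 hz)
  have hD : ∀ z v, fderiv ℝ θ z v = fderiv ℝ (fun w => fderiv ℝ φ w 1) z v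
      + I * fderiv ℝ (fun w => fderiv ℝ φ w I) z v := by
    intro z v
    have hd : ∀ u : ℂ, DifferentiableAt ℝ (fun w => fderiv ℝ φ w u) z := fun u =>
      (hφ.fderiv_apply_const u).differentiable (by simp) z
    rw [hθ_def, fderiv_fun_add (hd 1) ((hd I).const_mul I), fderiv_const_mul (hd I)]
    rfl
  have hsymm : ∀ z, fderiv ℝ (fun w => fderiv ℝ φ w 1) z I
      = fderiv ℝ (fun w => fderiv ℝ φ w I) z 1 := by
    intro z
    have hd : DifferentiableAt ℝ (fderiv ℝ φ) z :=
      (hφ.fderiv_right (m := ∞) (by simp)).differentiable (by simp) z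
    rw [fderiv_clm_apply hd (differentiableAt_const _),
      fderiv_clm_apply hd (differentiableAt_const _)]
    simp only [fderiv_fun_const, Pi.zero_apply, ContinuousLinearMap.comp_zero, zero_add,
      ContinuousLinearMap.flip_apply]
    exact (hφ.contDiffAt.isSymmSndFDerivAt (by
      rw [minSmoothness_of_isRCLikeNormedField]; exact WithTop.coe_le_coe.2 le_top)) I 1
  -- The factorization Δ = (∂x - i∂y)(∂x + i∂y). Only the outer factor is moved onto f, where it
  -- produces the complex gradient.
  have hLap : ∀ z, fderiv ℝ (fun w => fderiv ℝ φ w 1) z 1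
      + fderiv ℝ (fun w => fderiv ℝ φ w I) z I = fderiv ℝ θ z 1 - I * fderiv ℝ θ z I := by
    intro z
    rw [hD, hD, hsymm]
    linear_combination fderiv ℝ (fun w => fderiv ℝ φ w I) z I * I_mul_I
  have h1 := h.integral_smul_laplacian hφ hc hs
  have hparts := fun v => integral_smul_fderiv_of_tsupport_subset (μ := volume) hU h.smooth hθ hθc
    hθs v
  have hi : ∀ v : ℂ, Integrable fun z => f z • fderiv ℝ θ z v :=
    fun v => (h.smooth.continuousOn.locallyIntegrableOn
      hU.measurableSet).integrable_smul_of_tsupport_subset (hθ.fderiv_apply_const v).continuous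
      (hθc.fderiv_apply ℝ v) ((tsupport_fderiv_apply_subset (f := θ) ℝ v).trans hθs)
  have hi' : ∀ v : ℂ, Integrable fun z => fderiv ℝ f z v • θ z :=
    fun v => ((h.smooth.fderiv_apply_const hU v).continuousOn.locallyIntegrableOn
      hU.measurableSet).integrable_smul_of_tsupport_subset hθ.continuous hθc hθs
  have h2 : ∀ z, f z • (fderiv ℝ (fun w => fderiv ℝ φ w 1) z 1
      + fderiv ℝ (fun w => fderiv ℝ φ w I) z I)
      = f z • fderiv ℝ θ z 1 - I * (f z • fderiv ℝ θ z I) := fun z => by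
    rw [hLap, smul_sub, mul_smul_comm]
  rw [integral_congr_ae (Filter.Eventually.of_forall h2),
    integral_sub (hi 1) ((hi I).const_mul I), integral_const_mul, hparts, hparts] at h1
  have h3 : ∀ z, complexGradient f z * θ z = fderiv ℝ f z 1 • θ z - I * (fderiv ℝ f z I • θ z) :=
    fun z => by
      simp only [complexGradient, real_smul]
      ring
  rw [integral_congr_ae (Filter.Eventually.of_forall h3),
    integral_sub (hi' 1) ((hi' I).const_mul I), integral_const_mul]
  linear_combination -h1

end IsDiscGreen

end PlaneGreen

/-! ### Polar coordinates and radial cutoffs -/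

section PolarCoordinates

open Complex Metric

theorem Complex.polarCoord_symm_eq_circleMap (q : ℝ × ℝ) :
    Complex.polarCoord.symm q = circleMap 0 q.1 q.2 := by
  rw [Complex.polarCoord_symm_apply, circleMap_zero, exp_mul_I]
  push_cast
  rfl

/-- Integration in polar coordinates for a continuous function supported in a disc. -/
theorem integral_eq_intervalIntegral_circleMap {F : ℂ → ℂ} (hF : Continuous F) {B : ℝ} (hB : 0 ≤ B)
    (h0 : ∀ z, B < ‖z‖ → F z = 0) :
    ∫ z, F z = ∫ r in (0 : ℝ)..B, (r : ℂ) * ∫ t in (0 : ℝ)..2 * Real.pi, F (circleMap 0 r t) := by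
  have hcont : Continuous fun q : ℝ × ℝ => (q.1 : ℂ) * F (circleMap 0 q.1 q.2) := by
    refine (continuous_ofReal.comp continuous_fst).mul (hF.comp ?_)
    simp only [circleMap_zero]
    fun_prop
  have h1 : ∀ q : ℝ × ℝ, q.1 • F (Complex.polarCoord.symm q)
      = (q.1 : ℂ) * F (circleMap 0 q.1 q.2) := fun q => by
    rw [Complex.polarCoord_symm_eq_circleMap, real_smul]
  rw [← Complex.integral_comp_polarCoord_symm]
  simp only [h1]
  have hsub : Ioc 0 B ×ˢ Ioo (-Real.pi) Real.pi ⊆ polarCoord.target :=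
    prod_mono (fun r hr => hr.1) subset_rfl
  rw [setIntegral_eq_of_subset_of_forall_sdiff_eq_zero polarCoord.open_target.measurableSet hsub]
  · rw [Measure.volume_eq_prod, setIntegral_prod, intervalIntegral.integral_of_le hB]
    · refine setIntegral_congr_fun measurableSet_Ioc fun r hr => ?_
      simp only
      rw [integral_const_mul]
      congr 1
      rw [← integral_Ioc_eq_integral_Ioo,
        ← intervalIntegral.integral_of_le (by linarith [Real.pi_pos])]
      -- The polar chart uses angles in (-π, π), circle integrals use (0, 2π); periodicity shifts
      -- one to the other.
      have hper : Function.Periodic (fun t => F (circleMap 0 r t)) (2 * Real.pi) :=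
        (periodic_circleMap 0 r).comp F
      have := hper.intervalIntegral_add_eq (-Real.pi) 0
      rwa [zero_add, show -Real.pi + 2 * Real.pi = Real.pi by ring] at this
    · refine (hcont.continuousOn.integrableOn_compact
        (isCompact_Icc (a := (0 : ℝ)) (b := B) |>.prod
          (isCompact_Icc (a := -Real.pi) (b := Real.pi)))).mono_set ?_
      exact prod_mono Ioc_subset_Icc_self Ioo_subset_Icc_self
  · rintro q ⟨hq, hq'⟩
    have hq0 : 0 < q.1 := hq.1
    have hqB : B < q.1 := by
      by_contra hle
      exact hq' ⟨⟨hq0, not_lt.1 hle⟩, hq.2⟩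
    rw [h0 _ (by rwa [circleMap_zero, norm_mul, norm_exp_ofReal_mul_I, mul_one, norm_real,
      Real.norm_of_nonneg hq0.le]), mul_zero]

/-- A function of the squared modulus that is `1` near the origin and has compact support. -/
structure IsRadialCutoff (η : ℝ → ℝ) (a b : ℝ) : Prop where
  contDiff : ContDiff ℝ ∞ η
  pos : 0 < a
  lt : a < b
  eq_one : ∀ s, s ≤ a → η s = 1
  eq_zero : ∀ s, b ≤ s → η s = 0

theorem exists_isRadialCutoff {a b : ℝ} (ha : 0 < a) (hab : a < b) :
    ∃ η : ℝ → ℝ, IsRadialCutoff η a b := by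
  refine ⟨fun s => Real.smoothTransition ((b - s) / (b - a)), ?_, ha, hab, ?_, ?_⟩
  · exact Real.smoothTransition.contDiff.comp ((contDiff_const.sub contDiff_id).div_const _)
  · intro s hs
    refine Real.smoothTransition.one_of_one_le ?_
    rw [one_le_div (by linarith)]
    linarith
  · intro s hs
    exact Real.smoothTransition.zero_of_nonpos
      (div_nonpos_of_nonpos_of_nonneg (by linarith) (by linarith))

namespace IsRadialCutoff

variable {η : ℝ → ℝ} {a b : ℝ}

theorem deriv_eq_zero (h : IsRadialCutoff η a b) {s : ℝ} (hs : s ∉ Icc a b) : deriv η s = 0 := by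
  have hs' : s < a ∨ b < s := by
    by_contra! hcon
    exact hs hcon
  rcases hs' with hs' | hs'
  · have h1 : η =ᶠ[𝓝 s] fun _ => 1 := by
      filter_upwards [Iio_mem_nhds hs'] with x hx using h.eq_one x hx.le
    rw [h1.deriv_eq, deriv_const]
  · have h1 : η =ᶠ[𝓝 s] fun _ => 0 := by
      filter_upwards [Ioi_mem_nhds hs'] with x hx using h.eq_zero x hx.le
    rw [h1.deriv_eq, deriv_const]

theorem contDiff_normSq (h : IsRadialCutoff η a b) :
    ContDiff ℝ ∞ fun z : ℂ => η (normSq z) := by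
  have h1 : ContDiff ℝ ∞ fun z : ℂ => z.re * z.re + z.im * z.im :=
    (reCLM.contDiff.mul reCLM.contDiff).add (imCLM.contDiff.mul imCLM.contDiff)
  rw [show (fun z : ℂ => η (normSq z)) = η ∘ fun z : ℂ => z.re * z.re + z.im * z.im from
    funext fun z => by rw [Function.comp_apply, normSq_apply]]
  exact h.contDiff.comp h1

theorem tsupport_normSq_subset (h : IsRadialCutoff η a b) :
    tsupport (fun z : ℂ => η (normSq z)) ⊆ {z | normSq z ≤ b} := by
  refine closure_minimal (fun z hz => ?_) (isClosed_le continuous_normSq continuous_const)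
  by_contra hlt
  exact hz (h.eq_zero _ (not_le.1 hlt).le)

theorem tsupport_deriv_normSq_subset (h : IsRadialCutoff η a b) :
    tsupport (fun z : ℂ => 2 * deriv η (normSq z)) ⊆ {z | normSq z ∈ Icc a b} := by
  refine closure_minimal (fun z hz => ?_) (isClosed_Icc.preimage continuous_normSq)
  by_contra hnot
  exact hz (by simp only [h.deriv_eq_zero hnot, mul_zero])

theorem lt_of_normSq_le {b ρ : ℝ} (hρ : 0 < ρ) (hb : b < ρ ^ 2) {z : ℂ} (hz : normSq z ≤ b) :
    z ∈ ball (0 : ℂ) ρ := by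
  rw [mem_ball_zero_iff]
  rw [normSq_eq_norm_sq] at hz
  exact lt_of_pow_lt_pow_left₀ 2 hρ.le (hz.trans_lt hb)

theorem hasCompactSupport_smul (h : IsRadialCutoff η a b) {ρ : ℝ} (hρ : 0 < ρ) (hb : b < ρ ^ 2)
    (ψ : ℂ → ℂ) : HasCompactSupport fun z => η (normSq z) • ψ z := by
  refine HasCompactSupport.of_support_subset_isCompact (isCompact_closedBall (0 : ℂ) ρ) ?_
  intro z hz
  refine ball_subset_closedBall (lt_of_normSq_le hρ hb ?_)
  by_contra hlt
  refine hz ?_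
  simp only [h.eq_zero _ (not_le.1 hlt).le, zero_smul]

/-- The Cauchy–Riemann operator applied to a radial cutoff of a holomorphic function. -/
theorem fderiv_add_I_mul_fderiv (h : IsRadialCutoff η a b) {ρ : ℝ} (hρ : 0 < ρ) (hb : b < ρ ^ 2)
    {ψ : ℂ → ℂ} (hψ : DifferentiableOn ℂ ψ (ball 0 ρ)) (z : ℂ) :
    fderiv ℝ (fun z => η (normSq z) • ψ z) z 1 + I * fderiv ℝ (fun z => η (normSq z) • ψ z) z I
      = (2 * deriv η (normSq z)) • (ψ z * z) := by
  by_cases hz : normSq z ≤ b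
  · have hzρ := lt_of_normSq_le hρ hb hz
    have h1 : HasFDerivAt (fun z : ℂ => normSq z)
        (z.re • reCLM + z.re • reCLM + (z.im • imCLM + z.im • imCLM)) z := by
      simp only [normSq_apply]
      exact (reCLM.hasFDerivAt.mul reCLM.hasFDerivAt).add
        (imCLM.hasFDerivAt.mul imCLM.hasFDerivAt)
    have h2 := (((h.contDiff.differentiable (by simp)) (normSq z)).hasDerivAt.comp_hasFDerivAt z h1)
    have h3 := (hψ.differentiableAt
      (isOpen_ball.mem_nhds hzρ)).hasDerivAt.hasFDerivAt.restrictScalars ℝ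
    have h4 := (h2.smul h3).fderiv
    rw [show (fun z => η (normSq z) • ψ z) = (η ∘ fun z : ℂ => normSq z) • ψ from rfl, h4]
    simp
    -- The terms with ψ' cancel, since ψ_x + iψ_y = ψ' + i²ψ' = 0; only the derivative of the cutoff
    -- remains.
    apply Complex.ext <;> simp <;> ring
  · have h1 : (fun z => η (normSq z) • ψ z) =ᶠ[𝓝 z] fun _ => 0 := by
      filter_upwards [(isOpen_lt continuous_const continuous_normSq).mem_nhds (not_le.1 hz)]
        with x hx
      rw [h.eq_zero _ (le_of_lt hx), zero_smul]
    rw [h1.fderiv_eq, h.deriv_eq_zero fun hmem => hz hmem.2]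
    simp

/-- The integral of a function with constant circle integrals against the derivative of a radial
cutoff. -/
theorem integral_deriv_smul (h : IsRadialCutoff η a b) {ρ : ℝ} (hρ : 0 < ρ) (hb : b < ρ ^ 2)
    {q : ℂ → ℂ} (hq : ContinuousOn q (ball 0 ρ \ {0})) {C : ℂ}
    (hC : ∀ r, 0 < r → r < ρ → ∮ z in C(0, r), q z = C) :
    ∫ z, (2 * deriv η (normSq z)) • (q z * z) = I * C := by
  have hF : Continuous fun z : ℂ => (2 * deriv η (normSq z)) • (q z * z) := by
    refine (contDiff_smul_of_tsupport_subset (n := 0) (isOpen_puncturedBall ρ) ?_ ?_ ?_).continuous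
    · rw [contDiff_zero]
      exact continuous_const.mul ((h.contDiff.continuous_deriv (by simp)).comp continuous_normSq)
    · refine h.tsupport_deriv_normSq_subset.trans fun z hz => ⟨lt_of_normSq_le hρ hb hz.2, ?_⟩
      rintro rfl
      have := hz.1
      rw [map_zero] at this
      exact absurd h.pos (not_lt.2 this)
    · exact contDiffOn_zero.2 (hq.mul continuousOn_id)
  have hb0 : 0 < b := h.pos.trans h.lt
  have hsq : ∀ {r : ℝ}, 0 ≤ r → r ∉ Ico 0 ρ → r ^ 2 ∉ Icc a b := by
    intro r hr hr' hmem
    refine hr' ⟨hr, ?_⟩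
    exact lt_of_pow_lt_pow_left₀ 2 hρ.le (hmem.2.trans_lt hb)
  rw [integral_eq_intervalIntegral_circleMap hF hρ.le]
  · have h1 : ∀ r ∈ uIcc 0 ρ, (r : ℂ) * ∫ t in (0 : ℝ)..2 * Real.pi,
        (2 * deriv η (normSq (circleMap 0 r t))) • (q (circleMap 0 r t) * circleMap 0 r t)
        = ((deriv η (r ^ 2) * (2 * r) : ℝ) : ℂ) * (-I * C) := by
      intro r hr
      rw [uIcc_of_le hρ.le] at hr
      have hn : ∀ t, normSq (circleMap 0 r t) = r ^ 2 := fun t => by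
        rw [normSq_eq_norm_sq, norm_circleMap_zero, sq_abs]
      simp only [hn, intervalIntegral.integral_smul]
      by_cases hr' : r ^ 2 ∈ Icc a b
      · have hr0 : 0 < r := by
          rcases hr.1.eq_or_lt with h0 | h0
          · rw [← h0] at hr'
            have := hr'.1
            exact absurd h.pos (not_lt.2 (by simpa using this))
          · exact h0
        have hrρ : r < ρ := lt_of_pow_lt_pow_left₀ 2 hρ.le (hr'.2.trans_lt hb)
        have h2 := hC r hr0 hrρ
        rw [circleIntegral] at h2
        -- On the circle dz = iz dt, so z dt = -i dz.
        have h3 : ∀ t, q (circleMap 0 r t) * circleMap 0 r t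
            = -I * (deriv (circleMap 0 r) t • q (circleMap 0 r t)) := fun t => by
          rw [deriv_circleMap, smul_eq_mul]
          linear_combination (q (circleMap 0 r t) * circleMap 0 r t) * I_mul_I
        simp only [h3, intervalIntegral.integral_const_mul, h2, real_smul]
        push_cast
        ring
      · rw [h.deriv_eq_zero hr']
        simp
    rw [intervalIntegral.integral_congr h1, intervalIntegral.integral_mul_const,
      intervalIntegral.integral_ofReal]
    -- The integrand is the derivative of η(r²), which goes from 1 at r = 0 to 0 at r = ρ.
    have h4 : ∫ r in (0 : ℝ)..ρ, deriv η (r ^ 2) * (2 * r) = -1 := by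
      have h5 : ∀ r ∈ uIcc 0 ρ,
          HasDerivAt (fun r : ℝ => η (r ^ 2)) (deriv η (r ^ 2) * (2 * r)) r := by
        intro r _
        have h6 := ((h.contDiff.differentiable (by simp)) (r ^ 2)).hasDerivAt.comp r
          (hasDerivAt_pow 2 r)
        rw [show deriv η (r ^ 2) * (2 * r) = deriv η (r ^ 2) * ((2 : ℕ) * r ^ (2 - 1)) by simp]
        exact h6
      rw [intervalIntegral.integral_eq_sub_of_hasDerivAt h5, h.eq_zero _ hb.le,
        h.eq_one _ (by simpa using h.pos.le)]
      · norm_num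
      · refine Continuous.intervalIntegrable ?_ _ _
        exact ((h.contDiff.continuous_deriv (by simp)).comp (continuous_pow 2)).mul
          (continuous_const.mul continuous_id)
    rw [h4]
    push_cast
    ring
  · intro z hz
    rw [normSq_eq_norm_sq, h.deriv_eq_zero (hsq (norm_nonneg z) fun
      hmem => absurd hmem.2 (not_lt.2 hz.le))]
    simp

end IsRadialCutoff

end PolarCoordinates

/-! ### The simple pole of the complex gradient -/

section Residue

open Complex Metric

namespace IsDiscGreen

variable {f : ℂ → ℝ} {R : ℝ}

/-- With φ = η(|z|²)ψ(z) the function φ_x + iφ_y lives in an annulus off the pole. Integrating it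
against p gives φ(0) = ψ(0) by the equation, and i times the circle integral by polar coordinates.
-/
theorem circleIntegral_complexGradient_mul (h : IsDiscGreen f R) {ρ : ℝ} (hρR : ρ ≤ R)
    {ψ : ℂ → ℂ} (hψ : DifferentiableOn ℂ ψ (ball 0 ρ)) {r : ℝ} (hr : 0 < r) (hrρ : r < ρ) :
    ∮ z in C(0, r), complexGradient f z * ψ z = -I * ψ 0 := by
  have hρ : 0 < ρ := hr.trans hrρ
  obtain ⟨η, hη⟩ := exists_isRadialCutoff (a := ρ ^ 2 / 4) (b := ρ ^ 2 / 2) (by positivity)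
    (by have : 0 < ρ ^ 2 := by positivity
        linarith)
  have hb : ρ ^ 2 / 2 < ρ ^ 2 := by
    have : 0 < ρ ^ 2 := by positivity
    linarith
  have hsub : ball (0 : ℂ) ρ \ {0} ⊆ ball 0 R \ {0} :=
    fun z hz => ⟨ball_subset_ball hρR hz.1, hz.2⟩
  have hd : DifferentiableOn ℂ (fun z => complexGradient f z * ψ z) (ball 0 ρ \ {0}) :=
    (h.differentiableOn_complexGradient.mono hsub).mul (hψ.mono sdiff_subset)
  -- By Cauchy's theorem on an annulus, since the product is holomorphic off 0.
  have hconst : ∀ s t, 0 < s → s ≤ t → t < ρ → ∮ z in C(0, t), complexGradient f z * ψ z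
      = ∮ z in C(0, s), complexGradient f z * ψ z := by
    intro s t hs hst ht
    refine circleIntegral_eq_of_differentiable_on_annulus_off_countable hs hst countable_empty
      (hd.continuousOn.mono ?_) ?_
    · rintro z ⟨hz, hz'⟩
      refine ⟨closedBall_subset_ball ht hz, ?_⟩
      rintro rfl
      exact hz' (mem_ball_self hs)
    · rintro z ⟨⟨hz, hz'⟩, -⟩
      refine hd.differentiableAt ((isOpen_puncturedBall ρ).mem_nhds
        ⟨ball_subset_ball ht.le hz, ?_⟩)
      rintro rfl
      exact hz' (mem_closedBall_self hs.le)
  have hC := hη.integral_deriv_smul hρ hb hd.continuousOn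
    (C := ∮ z in C(0, r), complexGradient f z * ψ z) (by
      intro s hs hsρ
      rcases le_total s r with hsr | hsr
      · exact (hconst s r hs hsr hrρ).symm
      · exact hconst r s hr hsr hsρ)
  have hφs : tsupport (fun z => η (normSq z) • ψ z) ⊆ ball 0 ρ :=
    (tsupport_smul_subset_left _ _).trans
      (hη.tsupport_normSq_subset.trans fun z hz => IsRadialCutoff.lt_of_normSq_le hρ hb hz)
  have hfun := funext (hη.fderiv_add_I_mul_fderiv hρ hb hψ)
  have h1 := h.integral_complexGradient_mul
    (contDiff_smul_of_tsupport_subset isOpen_ball hη.contDiff_normSq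
      (hη.tsupport_normSq_subset.trans fun z hz => IsRadialCutoff.lt_of_normSq_le hρ hb hz)
      ((hψ.contDiffOn isOpen_ball).restrict_scalars ℝ))
    (hη.hasCompactSupport_smul hρ hb ψ) (hφs.trans (ball_subset_ball hρR)) (by
      rw [hfun]
      intro h0
      have h2 := (hη.tsupport_deriv_normSq_subset (tsupport_smul_subset_left _ _ h0)).1
      rw [map_zero] at h2
      exact absurd hη.pos (not_lt.2 h2))
  rw [map_zero, hη.eq_one 0 hη.pos.le, one_smul] at h1
  rw [← h1, ← mul_right_inj' I_ne_zero, ← hC]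
  have h3 : ∀ z, (2 * deriv η (normSq z)) • (complexGradient f z * ψ z * z)
      = complexGradient f z * (fderiv ℝ (fun z => η (normSq z) • ψ z) z 1
        + I * fderiv ℝ (fun z => η (normSq z) • ψ z) z I) := fun z => by
    rw [hη.fderiv_add_I_mul_fderiv hρ hb hψ, real_smul, real_smul]
    ring
  rw [integral_congr_ae (Filter.Eventually.of_forall h3), ← mul_assoc, mul_neg, I_mul_I]
  ring

/-- The complex gradient of a Green's function has a simple pole, with residue `-1/2π`. -/
theorem exists_differentiableOn_complexGradient (h : IsDiscGreen f R) {R₁ : ℝ} (hR₁ : 0 < R₁)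
    (hR : R₁ < R) : ∃ P : ℂ → ℂ, DifferentiableOn ℂ P (ball 0 R₁) ∧
      ∀ z ∈ ball (0 : ℂ) R₁, z ≠ 0 → complexGradient f z = P z - (2 * Real.pi * z)⁻¹ := by
  set p := complexGradient f with hp_def
  have hp := h.differentiableOn_complexGradient
  have hU := isOpen_puncturedBall R
  have hsphere : ∀ {r : ℝ}, 0 < r → r < R → sphere (0 : ℂ) r ⊆ ball 0 R \ {0} := by
    intro r hr hrR z hz
    rw [mem_sphere_zero_iff_norm] at hz
    refine ⟨by rw [mem_ball_zero_iff, hz]; exact hrR, ?_⟩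
    rintro rfl
    rw [norm_zero] at hz
    exact hr.ne hz
  -- P is the Cauchy integral over the outer circle, holomorphic inside; it remains to compute the
  -- contribution of an inner circle of radius |z|/2.
  refine ⟨fun z => (2 * Real.pi * I : ℂ)⁻¹ • ∮ w in C(0, R₁), (w - z)⁻¹ • p w, ?_, ?_⟩
  · have hps := hasFPowerSeriesOn_cauchy_integral (c := 0) (R := R₁.toNNReal) (f := p) (by
      rw [Real.coe_toNNReal _ hR₁.le]
      exact ((hp.continuousOn.mono (hsphere hR₁ hR)).circleIntegrable hR₁.le)) (by simpa using hR₁)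
    have hdiff := hps.differentiableOn
    rwa [Metric.eball_coe, Real.coe_toNNReal _ hR₁.le] at hdiff
  · intro z hz hz0
    have hzn : 0 < ‖z‖ := norm_pos_iff.2 hz0
    have hzR := mem_ball_zero_iff.1 hz
    set r := ‖z‖ / 2 with hr_def
    have hr : 0 < r := by positivity
    have hrz : r < ‖z‖ := half_lt_self hzn
    have hzU : z ∈ ball (0 : ℂ) R \ {0} := ⟨ball_subset_ball hR.le hz, hz0⟩
    -- The slope (p(w) - p(z))/(w - z) extends continuously to w = z, so its circle integrals over
    -- the two boundary circles of the annulus agree.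
    have hann := circleIntegral_eq_of_differentiable_on_annulus_off_countable hr
      (hrz.trans hzR).le (f := dslope p z) (countable_singleton z)
      (((continuousOn_dslope (hU.mem_nhds hzU)).2 ⟨hp.continuousOn,
        hp.differentiableAt (hU.mem_nhds hzU)⟩).mono (by
          rintro w ⟨hw, hw'⟩
          refine ⟨closedBall_subset_ball hR hw, ?_⟩
          rintro rfl
          exact hw' (mem_ball_self hr))) (by
          rintro w ⟨⟨hw, hw'⟩, hwz⟩
          rw [differentiableAt_dslope_of_ne hwz]
          refine hp.differentiableAt (hU.mem_nhds ⟨ball_subset_ball hR.le hw, ?_⟩)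
          rintro rfl
          exact hw' (mem_closedBall_self hr.le))
    have hsplit : ∀ s, 0 < s → s < R → s ≠ ‖z‖ → ∮ w in C(0, s), dslope p z w
        = (∮ w in C(0, s), (w - z)⁻¹ • p w) - (∮ w in C(0, s), (w - z)⁻¹) * p z := by
      intro s hs hsR hsz
      have hne : ∀ w ∈ sphere (0 : ℂ) s, w - z ≠ 0 := by
        intro w hw h0
        rw [mem_sphere_zero_iff_norm, sub_eq_zero.1 h0] at hw
        exact hsz hw.symm
      have hci : ContinuousOn (fun w : ℂ => (w - z)⁻¹) (sphere 0 s) :=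
        (continuousOn_id.sub continuousOn_const).inv₀ hne
      have e1 : ∮ w in C(0, s), dslope p z w
          = ∮ w in C(0, s), ((w - z)⁻¹ • p w - (w - z)⁻¹ • p z) := by
        refine circleIntegral.integral_congr hs.le fun w hw => ?_
        rw [dslope_of_ne p (fun h0 => hne w hw (sub_eq_zero.2 h0)), slope_def_module, smul_sub]
      rw [e1, circleIntegral.integral_sub, circleIntegral.integral_smul_const, smul_eq_mul]
      · exact (hci.smul (hp.continuousOn.mono (hsphere hs hsR))).circleIntegrable hs.le
      · exact (hci.smul continuousOn_const).circleIntegrable hs.le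
    rw [hsplit R₁ hR₁ hR hzR.ne', hsplit r hr (hrz.trans (hzR.trans hR)) hrz.ne,
      circleIntegral.integral_sub_inv_of_mem_ball hz] at hann
    have hψ : DifferentiableOn ℂ (fun w : ℂ => (w - z)⁻¹) (ball 0 ‖z‖) := by
      intro w hw
      refine ((differentiableAt_id.sub_const z).inv ?_).differentiableWithinAt
      intro h0
      have h0' : w = z := sub_eq_zero.1 h0
      rw [h0', mem_ball_zero_iff] at hw
      exact hw.ne rfl
    have hr0 : ∮ w in C(0, r), (w - z)⁻¹ = 0 := by
      refine circleIntegral_eq_zero_of_differentiable_on_off_countable hr.le countable_empty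
        (hψ.continuousOn.mono (closedBall_subset_ball hrz)) fun w hw => ?_
      exact hψ.differentiableAt (isOpen_ball.mem_nhds (ball_subset_ball hrz.le hw.1))
    -- The Cauchy kernel 1/(w - z) is holomorphic for |w| < |z|, hence an admissible ψ; its value
    -- -1/z at 0 produces the polar part.
    have hres := h.circleIntegral_complexGradient_mul (hzR.trans hR).le hψ hr hrz
    have hcomm : ∮ w in C(0, r), (w - z)⁻¹ • p w = -I * (0 - z)⁻¹ := by
      rw [← hres]
      refine circleIntegral.integral_congr hr.le fun w _ => ?_
      exact mul_comm _ _
    rw [hr0, hcomm] at hann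
    have hpi : (Real.pi : ℂ) ≠ 0 := ofReal_ne_zero.2 Real.pi_ne_zero
    have hP : ∮ w in C(0, R₁), (w - z)⁻¹ • p w
        = -I * (0 - z)⁻¹ + 2 * Real.pi * I * p z := by
      linear_combination hann
    simp only
    rw [hP, smul_eq_mul, zero_sub]
    field_simp
    ring

end IsDiscGreen

end Residue

/-! ### The linearizing holomorphic coordinate -/

section HolomorphicCoordinate

open Complex Metric

namespace IsDiscGreen

variable {f : ℂ → ℝ} {R : ℝ}

/-- Up to the factor `-1/2π`, the complex gradient of a Green's function is the logarithmic
derivative of a holomorphic coordinate centred at the pole. -/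
theorem exists_coordinate (h : IsDiscGreen f R) (hR : 0 < R) :
    ∃ δ, 0 < δ ∧ δ ≤ R ∧ ∃ w : ℂ → ℂ, DifferentiableOn ℂ w (ball 0 δ) ∧ w 0 = 0 ∧
      (∀ z ∈ ball (0 : ℂ) δ, deriv w z ≠ 0) ∧
      ∀ z ∈ ball (0 : ℂ) δ, z ≠ 0 → w z ≠ 0 ∧
        2 * Real.pi * complexGradient f z * w z = -deriv w z := by
  have hpi : (Real.pi : ℂ) ≠ 0 := ofReal_ne_zero.2 Real.pi_ne_zero
  obtain ⟨P, hP, hpP⟩ := h.exists_differentiableOn_complexGradient (half_pos hR) (half_lt_self hR)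
  obtain ⟨Q, hQ⟩ := hP.isExactOn_ball
  -- Here w'/w = 1/z - 2πP = -2πp away from 0. The constant in the primitive Q is immaterial: it
  -- only multiplies w by a nonzero number.
  set w : ℂ → ℂ := fun z => z * exp (-(2 * Real.pi) * Q z) with hw_def
  have hw : ∀ z ∈ ball (0 : ℂ) (R / 2), HasDerivAt w
      (exp (-(2 * Real.pi) * Q z) * (1 - 2 * Real.pi * z * P z)) z := by
    intro z hz
    have h1 := (hasDerivAt_id z).mul ((hQ z hz).const_mul (-(2 * Real.pi : ℂ))).cexp
    refine h1.congr_deriv ?_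
    simp only [id]
    ring
  have hwd : DifferentiableOn ℂ w (ball 0 (R / 2)) :=
    fun z hz => (hw z hz).differentiableAt.differentiableWithinAt
  have h0 : (0 : ℂ) ∈ ball (0 : ℂ) (R / 2) := mem_ball_self (half_pos hR)
  have hcont : ContinuousAt (fun z => 1 - 2 * Real.pi * z * P z) 0 :=
    continuousAt_const.sub ((continuousAt_const.mul continuousAt_id).mul
      (hP.differentiableAt (isOpen_ball.mem_nhds h0)).continuousAt)
  have hev : ∀ᶠ z in 𝓝 (0 : ℂ), 1 - 2 * Real.pi * z * P z ≠ 0 :=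
    hcont.eventually_ne (by simp)
  obtain ⟨δ, hδ, hδs⟩ := Metric.eventually_nhds_iff_ball.1 (hev.and (isOpen_ball.mem_nhds h0))
  refine ⟨min δ R, lt_min hδ hR, min_le_right _ _, w, ?_, by simp [w], ?_, ?_⟩
  · exact hwd.mono fun z hz => (hδs z (ball_subset_ball (min_le_left _ _) hz)).2
  · intro z hz
    have h1 := hδs z (ball_subset_ball (min_le_left _ _) hz)
    rw [(hw z h1.2).deriv]
    exact mul_ne_zero (exp_ne_zero _) h1.1
  · intro z hz hz0
    have h1 := hδs z (ball_subset_ball (min_le_left _ _) hz)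
    refine ⟨mul_ne_zero hz0 (exp_ne_zero _), ?_⟩
    rw [(hw z h1.2).deriv, hpP z h1.2 hz0, hw_def]
    field_simp
    ring

end IsDiscGreen

end HolomorphicCoordinate

/-! ### Passage between ℂ and the coordinate plane -/

section PlaneCoordinates

/-- The standard identification of `ℂ` with the coordinate plane. -/
noncomputable abbrev toPlane : ℂ ≃ₗᵢ[ℝ] Plane := Complex.orthonormalBasisOneI.repr

theorem toPlane_one : toPlane 1 = EuclideanSpace.single 0 1 := by
  ext i
  fin_cases i <;> simp

theorem toPlane_I : toPlane Complex.I = EuclideanSpace.single 1 1 := by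
  ext i
  fin_cases i <;> simp

theorem fderiv_comp_toPlane (F : Plane → ℝ) (z v : ℂ) :
    fderiv ℝ (fun w => F (toPlane w)) z v = fderiv ℝ F (toPlane z) (toPlane v) := by
  have h := toPlane.toContinuousLinearEquiv.comp_right_fderiv (f := F) (x := z)
  exact congrArg (fun L : ℂ →L[ℝ] ℝ => L v) h

theorem partialDeriv_comp_toPlane_symm (φ : ℂ → ℝ) (i : Fin 2) (v : ℂ)
    (hv : toPlane v = EuclideanSpace.single i 1) :
    partialDeriv i (fun u => φ (toPlane.symm u)) = fun u => fderiv ℝ φ (toPlane.symm u) v := by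
  funext u
  have h := fderiv_comp_toPlane (fun u => φ (toPlane.symm u)) (toPlane.symm u) v
  simp only [LinearIsometryEquiv.symm_apply_apply, LinearIsometryEquiv.apply_symm_apply] at h
  rw [partialDeriv, ← hv, h]

end PlaneCoordinates

/-! ### From the surface to the flat disc -/

namespace Surface

section Isothermal

variable {M : Type*} [TopologicalSpace M] [ChartedSpace Plane M] [IsManifold (𝓡 2) ∞ M]
  {g : SurfaceMetric M} {e : OpenPartialHomeomorph M Plane} {lam : Plane → ℝ}

theorem IsIsothermal.areaDensity_eq (h : IsIsothermal g e lam) {u : Plane} (hu : u ∈ e.target) :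
    areaDensity g e u = lam u := by
  obtain ⟨hpos, hmat⟩ := h u hu
  rw [areaDensity, hmat, Matrix.det_smul, Matrix.det_one, mul_one, Fintype.card_fin,
    Real.sqrt_sq hpos.le]

/-- Conformal invariance in dimension two: √g = λ and the inverse metric is λ⁻¹ times the identity,
so √g·gⁱʲ is the identity matrix, and the outer 1/√g is cancelled by the area density. -/
theorem IsIsothermal.coordLaplacian_mul_areaDensity (h : IsIsothermal g e lam) (φ : Plane → ℝ)
    {u : Plane} (hu : u ∈ e.target) : coordLaplacian g e φ u * areaDensity g e u
      = partialDeriv 0 (partialDeriv 0 φ) u + partialDeriv 1 (partialDeriv 1 φ) u := by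
  have h1 : ∀ i, partialDeriv i (fun v => ∑ j, areaDensity g e v * (metricMatrix g e v)⁻¹ i j *
      partialDeriv j φ v) u = partialDeriv i (partialDeriv i φ) u := by
    intro i
    have h2 : (fun v => ∑ j, areaDensity g e v * (metricMatrix g e v)⁻¹ i j *
        partialDeriv j φ v) =ᶠ[𝓝 u] partialDeriv i φ := by
      filter_upwards [e.open_target.mem_nhds hu] with v hv
      obtain ⟨hpos, hmat⟩ := h v hv
      have hinv : (metricMatrix g e v)⁻¹ = (lam v)⁻¹ • (1 : Matrix (Fin 2) (Fin 2) ℝ) := by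
        refine Matrix.inv_eq_right_inv ?_
        rw [hmat, smul_mul_smul_comm, mul_inv_cancel₀ hpos.ne', one_smul, one_mul]
      simp [hinv, h.areaDensity_eq hv, Matrix.one_apply, hpos.ne']
    rw [partialDeriv, h2.fderiv_eq]
    rfl
  rw [coordLaplacian, h.areaDensity_eq hu, Fin.sum_univ_two, h1, h1]
  field_simp [(h u hu).1.ne']

end Isothermal

section GreenFunction

variable {M : Type*} [TopologicalSpace M] [ChartedSpace Plane M] [IsManifold (𝓡 2) ∞ M]

open Metric in
/-- In an isothermal chart, a Green's function of the surface is one of the flat Laplacian. -/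
theorem IsGreenFunction.isDiscGreen {g : SurfaceMetric M} {y : M} {G : M → ℝ}
    (hG : IsGreenFunction g y G) {e : OpenPartialHomeomorph M Plane}
    (he : e ∈ IsManifold.maximalAtlas (𝓡 2) ∞ M) (hy : y ∈ e.source) (hy0 : e y = 0)
    {lam : Plane → ℝ} (h : IsIsothermal g e lam) {R : ℝ} (hR : ball 0 R ⊆ e.target) :
    IsDiscGreen (fun z => G (e.symm (toPlane z))) R := by
  have hball : ∀ z, z ∈ ball (0 : ℂ) R ↔ toPlane z ∈ ball (0 : Plane) R := fun z => by
    rw [mem_ball_zero_iff, mem_ball_zero_iff, LinearIsometryEquiv.norm_map]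
  have hmp : MeasurePreserving toPlane := Complex.orthonormalBasisOneI.measurePreserving_repr
  have hme : MeasurableEmbedding toPlane :=
    toPlane.toHomeomorph.measurableEmbedding
  refine ⟨?_, ?_, ?_⟩
  · have h1 : ContDiffOn ℝ ∞ (fun u => G (e.symm u)) (e.target \ {0}) := by
      rw [← contMDiffOn_iff_contDiffOn]
      refine hG.smooth.comp ((contMDiffOn_symm_of_mem_maximalAtlas he).mono sdiff_subset) ?_
      rintro u ⟨hu, hu0⟩ huy
      have huy' : e.symm u = y := huy
      exact hu0 (by rw [mem_singleton_iff, ← e.right_inv hu, huy', hy0])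
    refine h1.comp toPlane.toContinuousLinearEquiv.contDiff.contDiffOn ?_
    rintro z ⟨hz, hz0⟩
    exact ⟨hR ((hball z).1 hz), fun h0 => hz0 (toPlane.map_eq_zero_iff.1 h0)⟩
  · rw [locallyIntegrableOn_iff isOpen_ball.isLocallyClosed]
    intro k hk hkc
    have h1 := (hG.locallyIntegrable e he).integrableOn_compact_subset
      (t := toPlane '' k) (by
        rintro _ ⟨z, hz, rfl⟩
        exact hR ((hball z).1 (hk hz))) (hkc.image toPlane.continuous)
    exact (hmp.integrableOn_image hme).1 h1
  · intro φ hφ hc hs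
    set φ' : Plane → ℝ := fun u => φ (toPlane.symm u) with hφ'
    have hsupp : tsupport φ' ⊆ e.target := by
      have h1 : tsupport φ' = toPlane.symm ⁻¹' tsupport φ :=
        tsupport_comp_eq_preimage φ toPlane.symm.toHomeomorph
      rw [h1]
      intro u hu
      have := (hball _).1 (hs hu)
      rw [LinearIsometryEquiv.apply_symm_apply] at this
      exact hR this
    have h1 := hG.laplacian_eq e he φ' (hφ.comp toPlane.symm.toContinuousLinearEquiv.contDiff)
      (hc.comp_homeomorph toPlane.symm.toHomeomorph) hsupp
    rw [if_pos hy, hy0] at h1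
    have hD : ∀ u, partialDeriv 0 (partialDeriv 0 φ') u + partialDeriv 1 (partialDeriv 1 φ') u
        = fderiv ℝ (fun w => fderiv ℝ φ w 1) (toPlane.symm u) 1
          + fderiv ℝ (fun w => fderiv ℝ φ w Complex.I) (toPlane.symm u) Complex.I := by
      intro u
      rw [partialDeriv_comp_toPlane_symm φ 0 1 toPlane_one,
        partialDeriv_comp_toPlane_symm φ 1 Complex.I toPlane_I,
        partialDeriv_comp_toPlane_symm (fun z => fderiv ℝ φ z 1) 0 1 toPlane_one,
        partialDeriv_comp_toPlane_symm (fun z => fderiv ℝ φ z Complex.I) 1 Complex.I toPlane_I]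
    -- Outside the chart's image the test function and its derivatives vanish, so the integral
    -- extends to the whole plane.
    have h2 : ∫ u in e.target, G (e.symm u) * coordLaplacian g e φ' u * areaDensity g e u
        = ∫ u, G (e.symm u) * (partialDeriv 0 (partialDeriv 0 φ') u
          + partialDeriv 1 (partialDeriv 1 φ') u) := by
      refine Eq.trans (setIntegral_congr_fun (g := fun u => G (e.symm u) *
        (partialDeriv 0 (partialDeriv 0 φ') u + partialDeriv 1 (partialDeriv 1 φ') u)) ?_ ?_)
        (setIntegral_eq_integral_of_forall_compl_eq_zero ?_)
      · exact e.open_target.measurableSet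
      · intro u hu
        simp only
        rw [mul_assoc, h.coordLaplacian_mul_areaDensity φ' hu]
      · intro u hu
        have h3 : ∀ i, partialDeriv i (partialDeriv i φ') u = 0 := by
          intro i
          by_contra hne
          exact hu (hsupp (tsupport_fderiv_apply_subset (f := φ') ℝ _
            (tsupport_fderiv_apply_subset (f := (partialDeriv i φ')) ℝ _
              (subset_tsupport (partialDeriv i (partialDeriv i φ')) hne))))
        rw [h3, h3, add_zero, mul_zero]
    rw [h2, ← hmp.integral_comp hme] at h1
    simp only [hD, LinearIsometryEquiv.symm_apply_apply] at h1
    rw [h1]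
    exact congrArg (fun z => -φ z) (map_zero toPlane.symm)

end GreenFunction

section Transfer

variable {M : Type*} [TopologicalSpace M] [ChartedSpace Plane M]
  {M₀ : Type*} [TopologicalSpace M₀] [ChartedSpace Plane M₀]

/-- The chart of `M` obtained from a chart of `M₀` by a diffeomorphism. -/
noncomputable def pushChart (Φ : M₀ ≃ₘ^∞⟮𝓡 2, 𝓡 2⟯ M) (e : OpenPartialHomeomorph M₀ Plane) :
    OpenPartialHomeomorph M Plane :=
  Φ.symm.toHomeomorph.toOpenPartialHomeomorph.trans e

variable {Φ : M₀ ≃ₘ^∞⟮𝓡 2, 𝓡 2⟯ M} {e : OpenPartialHomeomorph M₀ Plane}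

theorem pushChart_target : (pushChart Φ e).target = e.target := by
  simp [pushChart]

theorem pushChart_mem_source {q : M} : q ∈ (pushChart Φ e).source ↔ Φ.symm q ∈ e.source := by
  simp [pushChart]

theorem coordVector_pushChart (he : e ∈ IsManifold.maximalAtlas (𝓡 2) ∞ M₀) (i : Fin 2) {u : Plane}
    (hu : u ∈ e.target) : coordVector (pushChart Φ e) i u
      = mfderiv (𝓡 2) (𝓡 2) Φ (e.symm u) (coordVector e i u) := by
  have h := mfderiv_comp u (Φ.contMDiff.mdifferentiableAt (by simp) (x := e.symm u))
    ((mdifferentiable_of_mem_maximalAtlas he).mdifferentiableAt_symm hu)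
  exact congrArg (fun L : Plane →L[ℝ] Plane => L (EuclideanSpace.single i (1 : ℝ))) h

variable [IsManifold (𝓡 2) ∞ M]

theorem pushChart_mem_maximalAtlas (he : e ∈ IsManifold.maximalAtlas (𝓡 2) ∞ M₀) :
    pushChart Φ e ∈ IsManifold.maximalAtlas (𝓡 2) ∞ M := by
  rw [IsManifold.mem_maximalAtlas_iff_contMDiffOn]
  constructor
  · exact (contMDiffOn_of_mem_maximalAtlas he).comp Φ.symm.contMDiff.contMDiffOn
      fun q hq => pushChart_mem_source.1 hq
  · rw [pushChart_target]
    exact Φ.contMDiff.comp_contMDiffOn (contMDiffOn_symm_of_mem_maximalAtlas he)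

variable [IsManifold (𝓡 2) ∞ M₀]

/-- Φ carries the coordinate vectors of `e` to those of the transported chart, so conformality only
multiplies the factor λ by f. -/
theorem IsIsothermal.pushChart {g₀ : SurfaceMetric M₀} {g : SurfaceMetric M} {f : M₀ → ℝ}
    (hf : ∀ p, 0 < f p) (hΦ : ∀ (p : M₀) (v w : TangentSpace (𝓡 2) p),
      g.inner (Φ p) (mfderiv (𝓡 2) (𝓡 2) Φ p v) (mfderiv (𝓡 2) (𝓡 2) Φ p w)
        = f p * g₀.inner p v w)
    (he : e ∈ IsManifold.maximalAtlas (𝓡 2) ∞ M₀) {lam : Plane → ℝ} (h : IsIsothermal g₀ e lam) :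
    IsIsothermal g (pushChart Φ e) fun u => f (e.symm u) * lam u := by
  intro u hu
  rw [pushChart_target] at hu
  obtain ⟨hpos, hmat⟩ := h u hu
  refine ⟨mul_pos (hf _) hpos, ?_⟩
  ext i j
  have h1 : metricMatrix g (Surface.pushChart Φ e) u i j
      = g.inner (Φ (e.symm u)) (coordVector (Surface.pushChart Φ e) i u)
        (coordVector (Surface.pushChart Φ e) j u) := rfl
  have h2 : g₀.inner (e.symm u) (coordVector e i u) (coordVector e j u)
      = (lam u • (1 : Matrix (Fin 2) (Fin 2) ℝ)) i j := by
    rw [← hmat]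
    rfl
  rw [h1, coordVector_pushChart he i hu, coordVector_pushChart he j hu, hΦ, h2]
  simp [mul_assoc]

end Transfer

end Surface

/-! ### Holomorphic maps as real local diffeomorphisms -/

section HolomorphicMaps

open Metric

variable {w : ℂ → ℂ} {δ : ℝ}

theorem mem_ball_toPlane_symm {u : Plane} :
    toPlane.symm u ∈ ball (0 : ℂ) δ ↔ u ∈ ball (0 : Plane) δ := by
  rw [mem_ball_zero_iff, mem_ball_zero_iff, LinearIsometryEquiv.norm_map]

theorem contDiffOn_toPlane_conj (hw : DifferentiableOn ℂ w (ball 0 δ)) :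
    ContDiffOn ℝ ∞ (fun u => w (toPlane.symm u)) (ball 0 δ) :=
  ((hw.contDiffOn isOpen_ball).restrict_scalars ℝ).comp
    toPlane.symm.toContinuousLinearEquiv.contDiff.contDiffOn fun _ hu => mem_ball_toPlane_symm.2 hu

theorem fderiv_toPlane_conj (hw : DifferentiableOn ℂ w (ball 0 δ)) {u : Plane} (hu : u ∈ ball 0 δ)
    (v : Plane) : fderiv ℝ (fun u => toPlane (w (toPlane.symm u))) u v
      = toPlane (deriv w (toPlane.symm u) * toPlane.symm v) := by
  have h1 := (hw.differentiableAt (isOpen_ball.mem_nhds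
    (mem_ball_toPlane_symm.2 hu))).hasDerivAt.hasFDerivAt.restrictScalars ℝ
  have h2 := toPlane.toContinuousLinearEquiv.hasFDerivAt.comp u
    (h1.comp u toPlane.symm.toContinuousLinearEquiv.hasFDerivAt)
  have h3 := congrArg (fun L : Plane →L[ℝ] Plane => L v) h2.fderiv
  refine h3.trans (congrArg toPlane ?_)
  exact mul_comm _ _

/-- The real differential is complex multiplication by w', which is injective as soon as w' ≠ 0. -/
theorem exists_openPartialHomeomorph_of_deriv_ne_zero (hδ : 0 < δ)
    (hw : DifferentiableOn ℂ w (ball 0 δ)) (hw' : ∀ z ∈ ball (0 : ℂ) δ, deriv w z ≠ 0) :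
    ∃ ψ : OpenPartialHomeomorph Plane Plane, 0 ∈ ψ.source ∧ ψ.source ⊆ ball 0 δ ∧
      (∀ u, ψ u = toPlane (w (toPlane.symm u))) ∧
      ContDiffOn ℝ ∞ ψ ψ.source ∧ ContDiffOn ℝ ∞ ψ.symm ψ.target := by
  refine exists_openPartialHomeomorph_of_injective_fderiv isOpen_ball
    (toPlane.toContinuousLinearEquiv.contDiff.comp_contDiffOn (contDiffOn_toPlane_conj hw)) ?_
    (mem_ball_self hδ)
  intro u hu v v' hv
  have h := (fderiv_toPlane_conj hw hu v).symm.trans (hv.trans (fderiv_toPlane_conj hw hu v'))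
  exact toPlane.symm.injective
    (mul_left_cancel₀ (hw' _ (mem_ball_toPlane_symm.2 hu)) (toPlane.injective h))

end HolomorphicMaps

/-! ### The gradient in the new coordinate, and the node -/

namespace Surface

section Node

variable {M : Type*} [TopologicalSpace M] [ChartedSpace Plane M]
  {e : OpenPartialHomeomorph M Plane}

theorem coords_trans {ψ : OpenPartialHomeomorph Plane Plane}
    (he : e ∈ IsManifold.maximalAtlas (𝓡 2) ∞ M) (hψ : ContDiffOn ℝ ∞ ψ ψ.source) {p : M}
    (hp : p ∈ (e.trans ψ).source) (v : TangentSpace (𝓡 2) p) :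
    coords (e.trans ψ) p v = fderiv ℝ ψ (e p) (coords e p v) := by
  rw [OpenPartialHomeomorph.trans_source] at hp
  have h := mfderiv_comp p
    ((hψ.contDiffAt (ψ.open_source.mem_nhds hp.2)).differentiableAt (by simp)).mdifferentiableAt
    ((mdifferentiable_of_mem_maximalAtlas he).mdifferentiableAt hp.1)
  rw [mfderiv_eq_fderiv] at h
  exact congrArg (fun L : Plane →L[ℝ] Plane => L v) h

theorem eq_neg_sub_of_coords_eq_neg {p : M} {v : TangentSpace (𝓡 2) p}
    (he : e ∈ IsManifold.maximalAtlas (𝓡 2) ∞ M) (hp : p ∈ e.source)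
    (h : coords e p v = -e p) : (v : Plane)
      = -(e p 0) • (coordVector e 0 (e p) : Plane) - (e p 1) • (coordVector e 1 (e p) : Plane) := by
  obtain ⟨u, hu, rfl⟩ : ∃ u ∈ e.target, e.symm u = p := ⟨e p, e.map_source hp, e.left_inv hp⟩
  have h1 := sum_coordVector he hu v
  have h2 : ∀ i, coordVector e i (e (e.symm u)) = (coordVector e i u : Plane) := fun i =>
    congrArg (fun u => (coordVector e i u : Plane)) (e.right_inv hu)
  have h3 : ∀ i, coords e (e.symm u) v i = -(e (e.symm u) i) := fun i => by rw [h]; rfl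
  rw [h3, h3] at h1
  refine Eq.trans h1 ?_
  rw [h2, h2]
  have h4 : ∀ (a b : ℝ) (v w : Plane), -a • v + -b • w = -a • v - b • w := fun a b v w => by module
  exact h4 _ _ _ _

/-- A field which reads `-x` in a chart centred at `p` has a linearizable stable node at `p`. -/
theorem isLinearizableStableNode_of_coords_eq_neg {X : (q : M) → TangentSpace (𝓡 2) q} {p : M}
    (he : e ∈ IsManifold.maximalAtlas (𝓡 2) ∞ M) (hp : p ∈ e.source) (hp0 : e p = 0)
    (h : ∀ q ∈ e.source, coords e q (X q) = -e q) : IsLinearizableStableNode X p := by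
  -- The matrix is minus the identity, with characteristic polynomial (X + 1)².
  refine ⟨e, he, hp, hp0, -1, ⟨-1, -1, by norm_num, by norm_num, ?_⟩, fun q hq => ?_⟩
  · rw [Matrix.charpoly_fin_two]
    simp [Matrix.det_fin_two]
    linear_combination Polynomial.X * (map_ofNat (Polynomial.C : ℝ →+* Polynomial ℝ) 2)
  · rw [map_neg]
    refine (h q hq).trans ?_
    simp [Matrix.toEuclideanLin]

end Node

section ConformalGradient

open Metric

variable {M : Type*} [TopologicalSpace M] [ChartedSpace Plane M] [IsManifold (𝓡 2) ∞ M]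
  {g : SurfaceMetric M} {e : OpenPartialHomeomorph M Plane}

/-- As a complex number the Euclidean gradient is f_x + i f_y, the conjugate of the complex
gradient. -/
theorem coords_gradient_eq_toPlane (he : e ∈ IsManifold.maximalAtlas (𝓡 2) ∞ M) {lam : Plane → ℝ}
    (h : IsIsothermal g e lam) {u : Plane} (hu : u ∈ e.target) {H : M → ℝ}
    (hH : MDifferentiableAt (𝓡 2) 𝓘(ℝ, ℝ) H (e.symm u)) :
    coords e (e.symm u) (gradient g H (e.symm u)) = toPlane ((lam u)⁻¹ •
      (starRingEnd ℂ) (complexGradient (fun z => H (e.symm (toPlane z))) (toPlane.symm u))) := by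
  obtain ⟨z, rfl⟩ := toPlane.surjective u
  have h1 : ∀ i v, toPlane v = EuclideanSpace.single i 1 →
      partialDeriv i (fun v => H (e.symm v)) (toPlane z)
        = fderiv ℝ (fun z => H (e.symm (toPlane z))) z v := fun i v hv => by
    rw [partialDeriv, ← hv, fderiv_comp_toPlane fun v => H (e.symm v)]
  rw [LinearIsometryEquiv.symm_apply_apply]
  ext i
  rw [coords_gradient he h hu hH]
  revert i
  refine Fin.forall_fin_two.2 ⟨?_, ?_⟩
  · rw [h1 0 1 toPlane_one]
    simp [complexGradient]
  · rw [h1 1 Complex.I toPlane_I]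
    simp [complexGradient]

/-- A function whose complex gradient is, up to the factor `-1/2π`, the logarithmic derivative of a
holomorphic coordinate `w` has gradient proportional to the field `-x` in this coordinate. -/
theorem coords_smul_gradient (he : e ∈ IsManifold.maximalAtlas (𝓡 2) ∞ M) {lam : Plane → ℝ}
    (h : IsIsothermal g e lam) {H : M → ℝ} {w : ℂ → ℂ} {δ : ℝ}
    (hw : DifferentiableOn ℂ w (ball 0 δ)) (hw' : ∀ z ∈ ball (0 : ℂ) δ, deriv w z ≠ 0)
    {ψ : OpenPartialHomeomorph Plane Plane} (hψδ : ψ.source ⊆ ball 0 δ)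
    (hψ : ∀ u, ψ u = toPlane (w (toPlane.symm u))) (hψs : ContDiffOn ℝ ∞ ψ ψ.source) {p : M}
    (hp : p ∈ (e.trans ψ).source) (hH : MDifferentiableAt (𝓡 2) 𝓘(ℝ, ℝ) H p)
    (hgrad : 2 * Real.pi * complexGradient (fun z => H (e.symm (toPlane z))) (toPlane.symm (e p))
      * w (toPlane.symm (e p)) = -deriv w (toPlane.symm (e p))) :
    coords (e.trans ψ) p ((2 * Real.pi * lam (e p) *
      (‖w (toPlane.symm (e p))‖ ^ 2 / ‖deriv w (toPlane.symm (e p))‖ ^ 2)) • gradient g H p)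
      = -(e.trans ψ) p := by
  have hp' := hp
  rw [OpenPartialHomeomorph.trans_source] at hp'
  have hu : e p ∈ e.target := e.map_source hp'.1
  have hball := hψδ hp'.2
  have hcoords : coords e p (gradient g H p) = toPlane ((lam (e p))⁻¹ • (starRingEnd ℂ)
      (complexGradient (fun z => H (e.symm (toPlane z))) (toPlane.symm (e p)))) := by
    have hpe := e.left_inv hp'.1
    have h1 := coords_gradient_eq_toPlane he h hu (H := H) (by rwa [hpe])
    rwa [hpe] at h1
  rw [coords_trans he hψs hp, map_smul, hcoords, OpenPartialHomeomorph.coe_trans,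
    Function.comp_apply, hψ, map_smul, show (ψ : Plane → Plane) = fun u =>
      toPlane (w (toPlane.symm u)) from funext hψ, fderiv_toPlane_conj hw hball,
    LinearIsometryEquiv.symm_apply_apply, ← map_smul, ← map_neg]
  congr 1
  set z := toPlane.symm (e p)
  set c := complexGradient (fun z => H (e.symm (toPlane z))) z
  have hd : deriv w z ≠ 0 := hw' z (mem_ball_toPlane_symm.2 hball)
  have hd' : (starRingEnd ℂ) (deriv w z) ≠ 0 := (map_ne_zero _).2 hd
  have hlam : (lam (e p) : ℂ) ≠ 0 := Complex.ofReal_ne_zero.2 (h _ hu).1.ne'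
  -- The gradient involves conj(p), so the conjugate of 2πpw = -w' is used:
  -- 2π(|w|²/|w'|²)·w'·conj(p) = w·conj(2πpw)/conj(w') = -w.
  have hconj := congrArg (starRingEnd ℂ) hgrad
  simp only [map_mul, map_neg, Complex.conj_ofReal, map_ofNat] at hconj
  have hn : ∀ a : ℂ, ((‖a‖ : ℂ)) ^ 2 = a * (starRingEnd ℂ) a := fun a => by
    rw [Complex.mul_conj, Complex.normSq_eq_norm_sq]
    push_cast
    rfl
  simp only [Complex.real_smul]
  push_cast
  rw [hn, hn]
  field_simp
  linear_combination w z * hconj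

end ConformalGradient

end Surface

/-! ### The theorem -/

theorem propositionL {M : Type*} [TopologicalSpace M] [T2Space M] [SecondCountableTopology M]
    [ChartedSpace Plane M] [IsManifold (𝓡 2) ∞ M]
    {M₀ : Type*} [TopologicalSpace M₀] [T2Space M₀] [SecondCountableTopology M₀]
    [ChartedSpace Plane M₀] [IsManifold (𝓡 2) ∞ M₀]
    (g : SurfaceMetric M) (y : M) (G : M → ℝ) (hG : Surface.IsGreenFunction g y G)
    (g₀ : SurfaceMetric M₀) (hg₀ : Surface.HasConstantCurvature g₀)
    (Φ : M₀ ≃ₘ^∞⟮𝓡 2, 𝓡 2⟯ M) (hΦ : Surface.IsConformalIsometry g₀ g Φ) :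
    ∃ x ∈ IsManifold.maximalAtlas (𝓡 2) ∞ M₀,
      Φ.symm y ∈ x.source ∧ x (Φ.symm y) = 0 ∧
      ∃ ρ : M₀ → ℝ,
        ContMDiffOn (𝓡 2) 𝓘(ℝ, ℝ) ∞ ρ x.source ∧
        (∀ p ∈ x.source, 0 ≤ ρ p) ∧
        (∀ p ∈ x.source, ρ p = 0 ↔ p = Φ.symm y) ∧
        (∀ p ∈ x.source, p ≠ Φ.symm y →
          (ρ p • Surface.gradient g₀ (G ∘ Φ) p : Plane)
            = -(x p 0) • (Surface.coordVector x 0 (x p) : Plane)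
              - (x p 1) • (Surface.coordVector x 1 (x p) : Plane)) ∧
        Surface.IsLinearizableStableNode
          (fun p => ρ p • Surface.gradient g₀ (G ∘ Φ) p) (Φ.symm y) := by
  obtain ⟨f, -, hf, hfΦ⟩ := hΦ
  obtain ⟨e, he, hp₀, he0, lam, hiso⟩ := Surface.exists_isIsothermal hg₀ (Φ.symm y)
  have h0 : (0 : Plane) ∈ e.target := he0 ▸ e.map_source hp₀
  obtain ⟨R, hR, hRs⟩ := Metric.isOpen_iff.1 e.open_target 0 h0
  -- Read in the transported chart of M, the function G has the same expression as G ∘ Φ in `e`, so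
  -- the Green equation of g applies directly.
  have hdisc : IsDiscGreen (fun z => (G ∘ Φ) (e.symm (toPlane z))) R :=
    hG.isDiscGreen (Surface.pushChart_mem_maximalAtlas he) (Surface.pushChart_mem_source.2 hp₀) he0
      (hiso.pushChart hf hfΦ he) (by rwa [Surface.pushChart_target])
  obtain ⟨δ, hδ, -, w, hw, hw0, hw', hwc⟩ := hdisc.exists_coordinate hR
  obtain ⟨ψ, hψ0, hψδ, hψ, hψs, hψs'⟩ := exists_openPartialHomeomorph_of_deriv_ne_zero hδ hw hw'
  have hx := Surface.trans_mem_maximalAtlas he hψs hψs'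
  have hmem : ∀ p, p ∈ (e.trans ψ).source ↔ p ∈ e.source ∧ e p ∈ ψ.source := fun p => by
    rw [OpenPartialHomeomorph.trans_source]
    rfl
  have hxp : Φ.symm y ∈ (e.trans ψ).source := (hmem _).2 ⟨hp₀, he0.symm ▸ hψ0⟩
  have hx0 : (e.trans ψ) (Φ.symm y) = 0 := by
    rw [OpenPartialHomeomorph.coe_trans, Function.comp_apply, he0, hψ, map_zero, hw0, map_zero]
  -- The metric coefficient stands in for `lam`: the two agree on the image of the chart, and the
  -- smoothness of the coefficient is known.
  set ρ : M₀ → ℝ := fun p => 2 * Real.pi * Surface.metricMatrix g₀ e (e p) 0 0 *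
    (‖w (toPlane.symm (e p))‖ ^ 2 / ‖deriv w (toPlane.symm (e p))‖ ^ 2) with hρ
  have hz0 : ∀ p ∈ e.source, toPlane.symm (e p) = 0 ↔ p = Φ.symm y := by
    intro p hp
    rw [LinearIsometryEquiv.map_eq_zero_iff, ← he0, e.injOn.eq_iff hp hp₀]
  have hw_zero : ∀ p ∈ (e.trans ψ).source, w (toPlane.symm (e p)) = 0 ↔ p = Φ.symm y := by
    intro p hp
    obtain ⟨hpe, hpψ⟩ := (hmem p).1 hp
    rw [← hz0 p hpe]
    refine ⟨fun h => ?_, fun h => by rw [h, hw0]⟩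
    by_contra hne
    exact (hwc _ (mem_ball_toPlane_symm.2 (hψδ hpψ)) hne).1 h
  have hfield : ∀ p ∈ (e.trans ψ).source,
      Surface.coords (e.trans ψ) p (ρ p • Surface.gradient g₀ (G ∘ Φ) p) = -(e.trans ψ) p := by
    intro p hp
    obtain ⟨hpe, hpψ⟩ := (hmem p).1 hp
    -- At the pole the value of `gradient` carries no information, but ρ vanishes there, and so does
    -- the coordinate.
    by_cases hpy : p = Φ.symm y
    · have hρ0 : ρ p = 0 := by
        rw [hρ]
        simp only [(hw_zero p hp).2 hpy, norm_zero]
        simp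
      rw [hρ0, zero_smul, map_zero, hpy, hx0, neg_zero]
    · have hlam : Surface.metricMatrix g₀ e (e p) 0 0 = lam (e p) := by
        rw [(hiso _ (e.map_source hpe)).2]
        simp
      have hΦp : Φ p ≠ y := fun h => hpy (by rw [← h, Diffeomorph.symm_apply_apply])
      have hH : MDifferentiableAt (𝓡 2) 𝓘(ℝ, ℝ) (G ∘ Φ) p :=
        MDifferentiableAt.comp p
          ((hG.smooth.contMDiffAt (isOpen_compl_singleton.mem_nhds hΦp)).mdifferentiableAt
            (by simp))
          (Φ.contMDiff.mdifferentiableAt (by simp))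
      have h1 := Surface.coords_smul_gradient he hiso hw hw' hψδ hψ hψs hp hH
        (hwc _ (mem_ball_toPlane_symm.2 (hψδ hpψ)) fun h => hpy ((hz0 p hpe).1 h)).2
      rwa [← hlam] at h1
  refine ⟨e.trans ψ, hx, hxp, hx0, ρ, ?_, ?_, ?_, ?_, ?_⟩
  · have hr : ContDiffOn ℝ ∞ (fun u => 2 * Real.pi * Surface.metricMatrix g₀ e u 0 0 *
        (‖w (toPlane.symm u)‖ ^ 2 / ‖deriv w (toPlane.symm u)‖ ^ 2))
        (e.target ∩ Metric.ball 0 δ) := by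
      refine (contDiffOn_const.mul
        ((Surface.contDiffOn_metricMatrix g₀ he 0 0).mono inter_subset_left)).mul
        ((((contDiffOn_toPlane_conj hw).norm_sq ℝ).div
          ((contDiffOn_toPlane_conj (hw.deriv Metric.isOpen_ball)).norm_sq ℝ) fun u hu => ?_).mono
            inter_subset_right)
      exact pow_ne_zero 2 (norm_ne_zero_iff.2 (hw' _ (mem_ball_toPlane_symm.2 hu)))
    exact (contMDiffOn_iff_contDiffOn.2 hr).comp ((contMDiffOn_of_mem_maximalAtlas he).mono
      fun p hp => ((hmem p).1 hp).1) fun p hp =>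
        ⟨e.map_source ((hmem p).1 hp).1, hψδ ((hmem p).1 hp).2⟩
  · intro p hp
    have := Surface.metricMatrix_zero_zero_pos g₀ he (e.map_source ((hmem p).1 hp).1)
    rw [hρ]
    positivity
  · intro p hp
    have h1 := Surface.metricMatrix_zero_zero_pos g₀ he (e.map_source ((hmem p).1 hp).1)
    have h2 := norm_ne_zero_iff.2 (hw' _ (mem_ball_toPlane_symm.2 (hψδ ((hmem p).1 hp).2)))
    rw [← hw_zero p hp, hρ]
    beta_reduce
    generalize toPlane.symm (e p) = z at h2 ⊢
    simp [h1.ne', norm_ne_zero_iff.1 h2, Real.pi_ne_zero]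
  · intro p hp _
    exact Surface.eq_neg_sub_of_coords_eq_neg hx hp (hfield p hp)
  · exact Surface.isLinearizableStableNode_of_coords_eq_neg hx hxp hx0 hfield
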